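/- A (straight-line) drawing of a finite graph $G$ is a map $\beta\colon V(G)\to\mathbb R^2$, each edge $uv$ being drawn as the segment $\beta(u)\beta(v)$. It is \emph{plane} if $\beta$ is injective, no edge passes through a vertex other than its two ends, and any two distinct edges share no point except the position of a common end. For an injective map $\delta\colon V(G)\to\mathbb R^2$ let $$\mathrm{fix}(G,\delta)=\max_{\beta\text{ plane drawing of }G}\bigl|\{v\in V(G):\beta(v)=\delta(v)\}\bigr|,\qquad \mathrm{fix}(G)=\min_{\delta\colon V(G)\to\mathbb R^2\text{ injective}}\mathrm{fix}(G,\delta).$$ Let $C_n$ denote the cycle graph on $n$ vertices. \textbf{Theorem.} There is an absolute constant $C$ such that for every $n\ge 3$ $$\mathrm{fix}(C_n)\;\ge\;2^{-5/3}\,n^{2/3}-C\,n^{1/3}.$$ In particular, $\mathrm{fix}(C_n)=\Omega(n^{2/3})$ as $n\to\infty$. -/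

import Mathlib

/-- The Euclidean plane. -/
abbrev Plane : Type := EuclideanSpace ℝ (Fin 2)

/-- A straight-line drawing of `G`, given by the positions `β` of the vertices, is plane:
distinct vertices are at distinct points, an edge passes through no vertex other than its two
ends, and two distinct edges share no point other than the position of a common end. -/
structure IsPlaneDrawing {V : Type*} (G : SimpleGraph V) (β : V → Plane) : Prop where
  injective : Function.Injective β
  vertex_edge : ∀ u v w : V, G.Adj u v → β w ∈ segment ℝ (β u) (β v) → w = u ∨ w = v
  edge_edge : ∀ u v x y : V, G.Adj u v → G.Adj x y → s(u, v) ≠ s(x, y) →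
    segment ℝ (β u) (β v) ∩ segment ℝ (β x) (β y) ⊆ β '' ({u, v} ∩ {x, y})

/-- `fix(G, δ)`: the maximal number of vertices that keep their position `δ v` in a plane
straight-line drawing of the finite graph `G`. -/
noncomputable def fixAt {V : Type*} [Fintype V] (G : SimpleGraph V) (δ : V → Plane) : ℕ :=
  sSup {k : ℕ | ∃ β : V → Plane, IsPlaneDrawing G β ∧ k = {v : V | β v = δ v}.ncard}

/-- `fix(G)`: the minimum of `fix(G, δ)` over all placements `δ` of the vertices of `G` at
pairwise distinct points of the plane. -/
noncomputable def fixNumber {V : Type*} [Fintype V] (G : SimpleGraph V) : ℕ :=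
  sInf {k : ℕ | ∃ δ : V → Plane, Function.Injective δ ∧ k = fixAt G δ}

/-! Take linear coordinates in which the points have distinct abscissas, and cut them into vertical
strips. Vertex i is placed on the i-th of a family of curves, graphs of functions that increase
strictly with i. If each edge from i to i + 1 runs between its two curves, the path cannot meet
itself (`edge_edge_of_between`). The curves are zigzags with one steep and one connecting piece per
strip, and an edge whose ends lie on corresponding pieces of consecutive curves stays between them
(`openSegment_between`). Zigzags of large amplitude can be led through prescribed points that are
monotone inside each strip (`exists_zigzagData`). Between kept vertices the path moves by at most
one piece per step, which is possible as soon as j - i > 2 |s i - s j| for all kept i < j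
(`exists_walk`). The closing edge sits in an extra strip to the right of everything.

It remains to select many points. A strip of at most A(A+1)/2 points splits into A monotone
sequences (`exists_monotone_coloring`). Keeping one random sequence in each of 2h strips retains
about n/A points. A pair that is too close for the walk lies in different strips, so it survives
with probability 1/A^2, and there are about 3 A^2 h^2 such pairs at most (`card_conflicts_le`).
Deleting one point of each surviving pair leaves about n/A - 3h^2 points (`exists_selection`). Since
n is about h A^2, choosing h and A of order n^(1/3) gives order n^(2/3). -/

/-! ### Simple polygons and paths that climb through ordered graphs. -/

/-- The vertices `P 0, …, P (n - 1)` are the consecutive corners of a simple closed polygon. -/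
structure IsSimplePolygon (n : ℕ) (P : ℕ → ℝ × ℝ) : Prop where
  injective : ∀ i < n, ∀ j < n, P i = P j → i = j
  edge_edge : ∀ i j, i < j → j + 1 < n → ∀ z ∈ segment ℝ (P i) (P (i + 1)),
    z ∈ segment ℝ (P j) (P (j + 1)) → j = i + 1 ∧ z = P j
  edge_closing : ∀ i, i + 1 < n → ∀ z ∈ segment ℝ (P i) (P (i + 1)),
    z ∈ segment ℝ (P (n - 1)) (P 0) → (i = 0 ∧ z = P 0) ∨ (i + 1 = n - 1 ∧ z = P (n - 1))

theorem mem_segment_cases {P Q z : ℝ × ℝ} (hz : z ∈ segment ℝ P Q) :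
    z = P ∨ z = Q ∨ z ∈ openSegment ℝ P Q := by
  rw [← insert_endpoints_openSegment] at hz
  simpa using hz

/-- A polyline whose `i`-th corner lies on the graph of `f i` and whose `i`-th open edge lies
strictly between the graphs of `f i` and `f (i + 1)` does not meet itself, provided the functions
`f i` are pointwise strictly increasing in `i`. -/
theorem edge_edge_of_between {f : ℕ → ℝ → ℝ} (hf : ∀ x, StrictMono fun i => f i x) {n : ℕ}
    {P : ℕ → ℝ × ℝ} (hP : ∀ i < n, (P i).2 = f i (P i).1)
    (hE : ∀ i, i + 1 < n → ∀ z ∈ openSegment ℝ (P i) (P (i + 1)),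
      f i z.1 < z.2 ∧ z.2 < f (i + 1) z.1) :
    ∀ i j, i < j → j + 1 < n → ∀ z ∈ segment ℝ (P i) (P (i + 1)),
      z ∈ segment ℝ (P j) (P (j + 1)) → j = i + 1 ∧ z = P j := by
  have key : ∀ i, i + 1 < n → ∀ z ∈ segment ℝ (P i) (P (i + 1)), f i z.1 ≤ z.2 ∧
      (z = P (i + 1) ∨ z.2 < f (i + 1) z.1) := by
    intro i hi z hz
    rcases mem_segment_cases hz with rfl | rfl | h
    · refine ⟨(hP i (by omega)).ge, Or.inr ?_⟩
      rw [hP i (by omega)]; exact hf _ (Nat.lt_succ_self i)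
    · exact ⟨by rw [hP (i + 1) hi]; exact (hf _ (Nat.lt_succ_self i)).le, Or.inl rfl⟩
    · exact ⟨(hE i hi z h).1.le, Or.inr (hE i hi z h).2⟩
  intro i j hij hj z hz hz'
  have h1 := key i (by omega) z hz
  have h2 := key j hj z hz'
  have h3 : f (i + 1) z.1 ≤ f j z.1 := (hf z.1).monotone (by omega)
  rcases h1.2 with h | h
  · have h4 : z.2 = f (i + 1) z.1 := by rw [h]; exact hP (i + 1) (by omega)
    have h5 : j = i + 1 := by
      by_contra hne
      have : f (i + 1) z.1 < f j z.1 := hf z.1 (by omega)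
      linarith [h2.1]
    exact ⟨h5, h5 ▸ h⟩
  · linarith [h2.1]

theorem injective_of_graphs {f : ℕ → ℝ → ℝ} (hf : ∀ x, StrictMono fun i => f i x) {n : ℕ}
    {P : ℕ → ℝ × ℝ} (hP : ∀ i < n, (P i).2 = f i (P i).1) :
    ∀ i < n, ∀ j < n, P i = P j → i = j := by
  intro i hi j hj h
  have h1 := hP i hi
  rw [h, hP j hj] at h1
  exact ((hf _).injective h1).symm

/-- The comparison of a chord between two piecewise linear curves with these curves, where `l` and
`c` denote the values of two linear pieces and the curves are `max l c` or `min l c`. -/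
theorem chord_between {e l₀ l₁ c₀ c₁ l₀' l₁' c₀' c₁' y₀ y₁ t : ℝ} (he : e = 1 ∨ e = -1)
    (h₀ : y₀ = e * max (e * l₀) (e * c₀)) (h₁ : y₁ = e * max (e * l₁') (e * c₁'))
    (hl₀ : y₀ = l₀) (hl₁ : y₁ = l₁') (h1 : l₀ < l₀') (h2 : l₁ < l₁') (h3 : c₀ < c₀')
    (h4 : c₁ < c₁') (ht : 0 < t) (ht' : t < 1) :
    e * max (e * ((1 - t) * l₀ + t * l₁)) (e * ((1 - t) * c₀ + t * c₁)) <
        (1 - t) * y₀ + t * y₁ ∧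
      (1 - t) * y₀ + t * y₁ <
        e * max (e * ((1 - t) * l₀' + t * l₁')) (e * ((1 - t) * c₀' + t * c₁')) := by
  have hs : 0 < 1 - t := by linarith
  rcases he with rfl | rfl
  · simp only [one_mul] at *
    have hc₀ : c₀ ≤ y₀ := h₀ ▸ le_max_right _ _
    have hc₁ : c₁' ≤ y₁ := h₁ ▸ le_max_right _ _
    -- The chord must beat both pieces of the lower maximum but only one piece of the upper maximum;
    -- for minima the roles are exchanged.
    refine ⟨max_lt ?_ ?_, lt_of_lt_of_le ?_ (le_max_left _ _)⟩
    · nlinarith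
    · nlinarith [mul_nonneg hs.le (sub_nonneg.2 hc₀)]
    · nlinarith
  · simp only [neg_mul, one_mul, max_neg_neg, neg_neg] at *
    have hc₀ : y₀ ≤ c₀ := h₀ ▸ min_le_right _ _
    have hc₁ : y₁ ≤ c₁' := h₁ ▸ min_le_right _ _
    refine ⟨lt_of_le_of_lt (min_le_left _ _) ?_, lt_min ?_ ?_⟩
    · nlinarith
    · nlinarith
    · nlinarith [mul_nonneg ht.le (sub_nonneg.2 hc₁)]

/-! ### Zigzag curves: order, linear pieces and corners. -/

/-- Data of a family of zigzag curves. The plane is cut into vertical cells `[a s, a (s + 1)]`.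
In the cell `s` the `i`-th curve follows a line from the height `e s * D s + i` at `a s`, with
slope `w s i`, and then a line to the height `e (s + 1) * D (s + 1) + i` at `a (s + 1)`. -/
structure ZigzagData where
  a : ℕ → ℝ
  g : ℕ → ℝ
  e : ℕ → ℝ
  D : ℕ → ℝ
  w : ℕ → ℕ → ℝ
  a_lt_g : ∀ s, a s < g s
  g_lt_a : ∀ s, g s < a (s + 1)
  sign : ∀ s, e s = 1 ∨ e s = -1
  D_pos : ∀ s, 0 < D s
  w_mono : ∀ s, Monotone (w s)
  w_steep : ∀ s i, e s * (e s * D s + w s i * (g s - a s)) < -D (s + 1)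

namespace ZigzagData

variable (Z : ZigzagData)

/-- The steep line of the `i`-th curve in the cell `s`. -/
def steep (s i : ℕ) (x : ℝ) : ℝ := Z.e s * Z.D s + i + Z.w s i * (x - Z.a s)

/-- The slope of the connecting line in the cell `s`. -/
noncomputable def conSlope (s : ℕ) : ℝ :=
  (Z.e (s + 1) + Z.e s) * Z.D (s + 1) / (Z.a (s + 1) - Z.g s)

/-- The connecting line of the `i`-th curve in the cell `s`. -/
noncomputable def con (s i : ℕ) (x : ℝ) : ℝ :=
  Z.e (s + 1) * Z.D (s + 1) + i - Z.conSlope s * (Z.a (s + 1) - x)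

/-- The `i`-th curve in the cell `s`. -/
noncomputable def cellCurve (s i : ℕ) (x : ℝ) : ℝ :=
  Z.e s * max (Z.e s * Z.steep s i x) (Z.e s * Z.con s i x)

open Classical in
/-- The `i`-th curve. -/
noncomputable def curve (i : ℕ) (x : ℝ) : ℝ :=
  if h : ∃ s, x ∈ Set.Icc (Z.a s) (Z.a (s + 1)) then Z.cellCurve h.choose i x else i

theorem a_strictMono : StrictMono Z.a :=
  strictMono_nat_of_lt_succ fun s => (Z.a_lt_g s).trans (Z.g_lt_a s)

theorem con_g (s i : ℕ) : Z.con s i (Z.g s) = i - Z.e s * Z.D (s + 1) := by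
  have h : Z.a (s + 1) - Z.g s ≠ 0 := (sub_pos.2 (Z.g_lt_a s)).ne'
  rw [con, conSlope, div_mul_cancel₀ _ h]; ring

theorem e_mul_self (s : ℕ) : Z.e s * Z.e s = 1 := by
  rcases Z.sign s with h | h <;> simp [h]

theorem e_mul_w_neg (s i : ℕ) : Z.e s * Z.w s i < 0 := by
  have h1 := Z.w_steep s i
  have h2 := Z.e_mul_self s
  have h3 := Z.D_pos s
  have h4 := Z.D_pos (s + 1)
  have h5 := sub_pos.2 (Z.a_lt_g s)
  have h6 : Z.e s * (Z.e s * Z.D s + Z.w s i * (Z.g s - Z.a s)) =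
    Z.D s + (Z.e s * Z.w s i) * (Z.g s - Z.a s) := by linear_combination Z.D s * h2
  rw [h6] at h1
  by_contra hc
  have := mul_nonneg (not_lt.1 hc) h5.le
  linarith

theorem e_mul_conSlope_nonneg (s : ℕ) : 0 ≤ Z.e s * Z.conSlope s := by
  have h := (sub_pos.2 (Z.g_lt_a s))
  have h4 := Z.D_pos (s + 1)
  rw [conSlope, ← mul_div_assoc]
  apply div_nonneg _ h.le
  rw [← mul_assoc]
  apply mul_nonneg _ h4.le
  rcases Z.sign s with h | h <;> rcases Z.sign (s + 1) with h' | h' <;> rw [h, h'] <;> norm_num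

/-- The abscissa of the bend in the interior of the cell `s`. -/
noncomputable def bend (s i : ℕ) : ℝ :=
  (Z.e s * Z.D s + Z.conSlope s * Z.a (s + 1) - Z.e (s + 1) * Z.D (s + 1) - Z.w s i * Z.a s) /
    (Z.conSlope s - Z.w s i)

theorem e_mul_slope_sub_pos (s i : ℕ) : 0 < Z.e s * (Z.conSlope s - Z.w s i) := by
  have h1 := Z.e_mul_w_neg s i
  have h2 := Z.e_mul_conSlope_nonneg s
  linarith [mul_sub (Z.e s) (Z.conSlope s) (Z.w s i)]

theorem e_mul_con_sub_steep (s i : ℕ) (x : ℝ) : Z.e s * (Z.con s i x - Z.steep s i x) =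
    Z.e s * (Z.conSlope s - Z.w s i) * (x - Z.bend s i) := by
  have h : Z.conSlope s - Z.w s i ≠ 0 := by
    intro h0
    have := Z.e_mul_slope_sub_pos s i
    rw [h0] at this; simp at this
  have : (Z.conSlope s - Z.w s i) * Z.bend s i = Z.e s * Z.D s + Z.conSlope s * Z.a (s + 1) -
      Z.e (s + 1) * Z.D (s + 1) - Z.w s i * Z.a s := by rw [bend, mul_div_cancel₀ _ h]
  rw [con, steep]
  linear_combination Z.e s * this

/-- After multiplication by `e s`, and up to the common shift by i, the connecting line has height
-D (s + 1) at `g s`, and `w_steep` puts the steep line below that. -/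
theorem bend_lt_g (s i : ℕ) : Z.bend s i < Z.g s := by
  have h1 := Z.e_mul_con_sub_steep s i (Z.g s)
  have h2 := Z.e_mul_slope_sub_pos s i
  have h3 := Z.w_steep s i
  have h4 := Z.e_mul_self s
  have h5 : 0 < Z.e s * (Z.con s i (Z.g s) - Z.steep s i (Z.g s)) := by
    have h6 : Z.e s * (Z.con s i (Z.g s) - Z.steep s i (Z.g s)) =
        -Z.D (s + 1) - Z.e s * (Z.e s * Z.D s + Z.w s i * (Z.g s - Z.a s)) := by
      rw [con_g, steep]; linear_combination (-Z.D (s + 1)) * h4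
    linarith
  rw [h1] at h5
  have := (pos_iff_pos_of_mul_pos h5).1 h2
  linarith

theorem steep_a (s i : ℕ) : Z.steep s i (Z.a s) = Z.e s * Z.D s + i := by simp [steep]

theorem con_a (s i : ℕ) : Z.con s i (Z.a (s + 1)) = Z.e (s + 1) * Z.D (s + 1) + i := by
  simp [con]

/-- In the same normalisation the steep line starts at D s > 0, while the connecting line,
nondecreasing, is at most -D (s + 1) < 0 there. -/
theorem a_lt_bend (s i : ℕ) : Z.a s < Z.bend s i := by
  have h1 := Z.e_mul_con_sub_steep s i (Z.a s)
  have h2 := Z.e_mul_slope_sub_pos s i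
  have h4 := Z.e_mul_self s
  have h5 : Z.e s * (Z.con s i (Z.a s) - Z.steep s i (Z.a s)) < 0 := by
    have h6 : Z.con s i (Z.a s) = Z.con s i (Z.g s) - Z.conSlope s * (Z.g s - Z.a s) := by
      rw [con, con]; ring
    rw [h6, con_g, steep_a]
    have h7 := mul_nonneg (Z.e_mul_conSlope_nonneg s) (sub_pos.2 (Z.a_lt_g s)).le
    have := Z.D_pos s
    have := Z.D_pos (s + 1)
    nlinarith
  rw [h1] at h5
  by_contra hc
  have := mul_nonneg h2.le (sub_nonneg.2 (not_lt.1 hc))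
  linarith

theorem bend_lt_a (s i : ℕ) : Z.bend s i < Z.a (s + 1) := (Z.bend_lt_g s i).trans (Z.g_lt_a s)

theorem cellCurve_of_le_bend {s i : ℕ} {x : ℝ} (hx : x ≤ Z.bend s i) :
    Z.cellCurve s i x = Z.steep s i x := by
  have h1 := Z.e_mul_con_sub_steep s i x
  have h2 := mul_nonneg (Z.e_mul_slope_sub_pos s i).le (sub_nonneg.2 hx)
  rw [cellCurve, max_eq_left (by linarith), ← mul_assoc, e_mul_self, one_mul]

theorem cellCurve_of_bend_le {s i : ℕ} {x : ℝ} (hx : Z.bend s i ≤ x) :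
    Z.cellCurve s i x = Z.con s i x := by
  have h1 := Z.e_mul_con_sub_steep s i x
  have h2 := mul_nonneg (Z.e_mul_slope_sub_pos s i).le (sub_nonneg.2 hx)
  rw [cellCurve, max_eq_right (by linarith), ← mul_assoc, e_mul_self, one_mul]

theorem steep_eq_con_bend (s i : ℕ) : Z.steep s i (Z.bend s i) = Z.con s i (Z.bend s i) := by
  rw [← Z.cellCurve_of_le_bend le_rfl, Z.cellCurve_of_bend_le le_rfl]

/-- The choice of cell is immaterial: distinct cells meet only at a common boundary `a (s + 1)`,
where both descriptions give the height e (s + 1) * D (s + 1) + i. -/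
theorem curve_eq {s : ℕ} {x : ℝ} (hx : x ∈ Set.Icc (Z.a s) (Z.a (s + 1))) (i : ℕ) :
    Z.curve i x = Z.cellCurve s i x := by
  have h : ∃ s, x ∈ Set.Icc (Z.a s) (Z.a (s + 1)) := ⟨s, hx⟩
  have key : ∀ r t : ℕ, r < t → x ∈ Set.Icc (Z.a r) (Z.a (r + 1)) →
      x ∈ Set.Icc (Z.a t) (Z.a (t + 1)) → Z.cellCurve r i x = Z.cellCurve t i x := by
    intro r t hrt hr ht
    have h1 : Z.a (r + 1) ≤ Z.a t := Z.a_strictMono.monotone hrt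
    have h2 : Z.a (r + 1) = Z.a t := le_antisymm h1 (ht.1.trans hr.2)
    have h3 := Z.a_strictMono.injective h2
    subst h3
    have h4 : x = Z.a (r + 1) := le_antisymm hr.2 ht.1
    subst h4
    rw [Z.cellCurve_of_bend_le (Z.bend_lt_a r i).le, Z.cellCurve_of_le_bend (Z.a_lt_bend _ i).le,
      con_a, steep_a]
  rw [curve, dif_pos h]
  rcases lt_trichotomy h.choose s with h' | h' | h'
  · exact key _ _ h' h.choose_spec hx
  · rw [h']
  · exact (key _ _ h' hx h.choose_spec).symm

theorem steep_lt {s i j : ℕ} (hij : i < j) {x : ℝ} (hx : Z.a s ≤ x) :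
    Z.steep s i x < Z.steep s j x := by
  have h1 := mul_le_mul_of_nonneg_right (Z.w_mono s hij.le) (sub_nonneg.2 hx)
  have h2 : (i : ℝ) < j := by exact_mod_cast hij
  rw [steep, steep]; linarith

theorem con_lt {s i j : ℕ} (hij : i < j) (x : ℝ) : Z.con s i x < Z.con s j x := by
  have h2 : (i : ℝ) < j := by exact_mod_cast hij
  rw [con, con]; linarith

theorem cellCurve_lt {s i j : ℕ} (hij : i < j) {x : ℝ} (hx : Z.a s ≤ x) :
    Z.cellCurve s i x < Z.cellCurve s j x := by
  have h1 := Z.steep_lt hij hx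
  have h2 := Z.con_lt (s := s) hij x
  rw [cellCurve, cellCurve]
  rcases Z.sign s with h | h <;> rw [h]
  · simp only [one_mul]; exact max_lt_max h1 h2
  · simp only [neg_mul, one_mul, max_neg_neg, neg_neg]; exact min_lt_min h1 h2

/-- The default value i outside all cells makes the order hold on the whole line, so the crossing
argument needs no domain condition. -/
theorem curve_strictMono (x : ℝ) : StrictMono fun i => Z.curve i x := by
  intro i j hij
  by_cases h : ∃ s, x ∈ Set.Icc (Z.a s) (Z.a (s + 1))
  · obtain ⟨s, hs⟩ := h
    simp only [Z.curve_eq hs]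
    exact Z.cellCurve_lt hij hs.1
  · simp only [curve, dif_neg h]
    exact_mod_cast hij

/-- The `t`-th linear piece of the `i`-th curve, extended to a line. -/
noncomputable def piece (t i : ℕ) (x : ℝ) : ℝ :=
  if t % 2 = 0 then Z.steep (t / 2) i x else Z.con (t / 2) i x

/-- The point `p` lies on the `t`-th linear piece of the `i`-th curve. -/
structure OnPiece (t i : ℕ) (p : ℝ × ℝ) : Prop where
  mem_cell : p.1 ∈ Set.Icc (Z.a (t / 2)) (Z.a (t / 2 + 1))
  eq_cellCurve : p.2 = Z.cellCurve (t / 2) i p.1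
  eq_piece : p.2 = Z.piece t i p.1

theorem OnPiece.eq_curve {Z : ZigzagData} {t i : ℕ} {p : ℝ × ℝ} (h : Z.OnPiece t i p) :
    p.2 = Z.curve i p.1 := by rw [Z.curve_eq h.mem_cell, h.eq_cellCurve]

/-- Since both ends lie on the same kind of piece in one cell, `chord_between` applies with that
piece in the role of l and the other piece in the role of c. -/
theorem openSegment_between {t i : ℕ} {p q : ℝ × ℝ} (hp : Z.OnPiece t i p)
    (hq : Z.OnPiece t (i + 1) q) {z : ℝ × ℝ} (hz : z ∈ openSegment ℝ p q) :
    Z.curve i z.1 < z.2 ∧ z.2 < Z.curve (i + 1) z.1 := by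
  obtain ⟨u, v, hu, hv, huv, rfl⟩ := hz
  obtain rfl : u = 1 - v := by linarith
  set s := t / 2 with hs
  have hmem : ((1 - v) • p + v • q).1 ∈ Set.Icc (Z.a s) (Z.a (s + 1)) :=
    convex_Icc _ _ hp.mem_cell hq.mem_cell hu.le hv.le huv
  rw [Z.curve_eq hmem, Z.curve_eq hmem]
  have e1 : ∀ j, Z.steep s j ((1 - v) * p.1 + v * q.1) =
      (1 - v) * Z.steep s j p.1 + v * Z.steep s j q.1 := by
    intro j; simp only [steep]; ring
  have e2 : ∀ j, Z.con s j ((1 - v) * p.1 + v * q.1) =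
      (1 - v) * Z.con s j p.1 + v * Z.con s j q.1 := by
    intro j; simp only [con]; ring
  have s1 := Z.steep_lt (Nat.lt_succ_self i) hp.mem_cell.1
  have s2 := Z.steep_lt (Nat.lt_succ_self i) hq.mem_cell.1
  have s3 := Z.con_lt (s := s) (Nat.lt_succ_self i) p.1
  have s4 := Z.con_lt (s := s) (Nat.lt_succ_self i) q.1
  have hp2 := hp.eq_piece
  have hq2 := hq.eq_piece
  simp only [Prod.fst_add, Prod.smul_fst, Prod.snd_add, Prod.smul_snd, smul_eq_mul, cellCurve,
    e1, e2]
  rw [piece] at hp2 hq2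
  split_ifs at hp2 hq2
  · exact chord_between (Z.sign s) hp.eq_cellCurve hq.eq_cellCurve hp2 hq2 s1 s2 s3 s4 hv
      (by linarith)
  · have := chord_between (Z.sign s) (hp.eq_cellCurve.trans (by rw [cellCurve, max_comm]))
      (hq.eq_cellCurve.trans (by rw [cellCurve, max_comm])) hp2 hq2 s3 s4 s1 s2 hv (by linarith)
    rwa [max_comm, max_comm (Z.e s * ((1 - v) * Z.con s (i + 1) p.1 + _))] at this

/-- The `t`-th corner of the `i`-th curve. -/
noncomputable def corner (t i : ℕ) : ℝ × ℝ :=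
  if t % 2 = 0 then (Z.a (t / 2), Z.e (t / 2) * Z.D (t / 2) + i)
  else (Z.bend (t / 2) i, Z.steep (t / 2) i (Z.bend (t / 2) i))

theorem corner_onPiece (t i : ℕ) : Z.OnPiece t i (Z.corner t i) := by
  by_cases h : t % 2 = 0
  · have hc : Z.corner t i = (Z.a (t / 2), Z.e (t / 2) * Z.D (t / 2) + i) := by
      rw [corner, if_pos h]
    rw [hc]
    refine ⟨⟨le_rfl, (Z.a_strictMono (Nat.lt_succ_self _)).le⟩, ?_, ?_⟩
    · rw [Z.cellCurve_of_le_bend (Z.a_lt_bend _ i).le, steep_a]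
    · rw [piece, if_pos h, steep_a]
  · have hc : Z.corner t i = (Z.bend (t / 2) i, Z.steep (t / 2) i (Z.bend (t / 2) i)) := by
      rw [corner, if_neg h]
    rw [hc]
    refine ⟨⟨(Z.a_lt_bend _ i).le, (Z.bend_lt_a _ i).le⟩, ?_, ?_⟩
    · rw [Z.cellCurve_of_le_bend le_rfl]
    · rw [piece, if_neg h, steep_eq_con_bend]

theorem corner_succ_onPiece (t i : ℕ) : Z.OnPiece t i (Z.corner (t + 1) i) := by
  by_cases h : t % 2 = 0
  · have h1 : (t + 1) / 2 = t / 2 := by omega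
    have hc : Z.corner (t + 1) i = (Z.bend (t / 2) i, Z.steep (t / 2) i (Z.bend (t / 2) i)) := by
      rw [corner, if_neg (by omega), h1]
    rw [hc]
    refine ⟨⟨(Z.a_lt_bend _ i).le, (Z.bend_lt_a _ i).le⟩, ?_, ?_⟩
    · rw [Z.cellCurve_of_le_bend le_rfl]
    · rw [piece, if_pos h]
  · have h1 : (t + 1) / 2 = t / 2 + 1 := by omega
    have hc : Z.corner (t + 1) i =
        (Z.a (t / 2 + 1), Z.e (t / 2 + 1) * Z.D (t / 2 + 1) + i) := by
      rw [corner, if_pos (by omega), h1]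
    rw [hc]
    refine ⟨⟨(Z.a_strictMono (Nat.lt_succ_self _)).le, le_rfl⟩, ?_, ?_⟩
    · rw [Z.cellCurve_of_bend_le (Z.bend_lt_a _ i).le, con_a]
    · rw [piece, if_neg h, con_a]

theorem corner_fst_le {t i m : ℕ} (h : t ≤ 2 * m) : (Z.corner t i).1 ≤ Z.a m := by
  by_cases h0 : t % 2 = 0
  · rw [corner, if_pos h0]
    exact Z.a_strictMono.monotone (by omega)
  · rw [corner, if_neg h0]
    exact (Z.bend_lt_a _ i).le.trans (Z.a_strictMono.monotone (by omega))

/-- This is how a kept vertex sits on a steep piece: the last hypothesis says that the steep line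
realises the maximum (or minimum) at p. -/
theorem station_onPiece {s i : ℕ} {p : ℝ × ℝ} (h1 : Z.a s ≤ p.1) (h2 : p.1 ≤ Z.g s)
    (h3 : p.2 = Z.steep s i p.1) (h4 : Z.e s * Z.con s i p.1 ≤ Z.e s * p.2) :
    Z.OnPiece (2 * s) i p := by
  have hs : 2 * s / 2 = s := by omega
  refine ⟨?_, ?_, ?_⟩
  · rw [hs]; exact ⟨h1, h2.trans (Z.g_lt_a s).le⟩
  · rw [hs, cellCurve, max_eq_left (h3 ▸ h4), ← mul_assoc, e_mul_self, one_mul, h3]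
  · rw [piece, if_pos (by omega), hs, h3]

end ZigzagData

/-! ### The walk from piece to piece. -/

/-- A walk on `ℕ` with steps of size at most one which stays for one step at the prescribed
places. -/
theorem exists_walk (T : Finset ℕ) (s : ℕ → ℕ) (m : ℕ) (hs : ∀ i ∈ T, s i ≤ m)
    (hgap : ∀ i ∈ T, ∀ j ∈ T, i < j →
      2 * s i + i + 1 ≤ 2 * s j + j ∧ 2 * s j + i + 1 ≤ 2 * s i + j) :
    ∃ π : ℕ → ℕ, (∀ k, π k ≤ 2 * m) ∧ (∀ k, π (k + 1) ≤ π k + 1 ∧ π k ≤ π (k + 1) + 1) ∧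
      (∀ i ∈ T, π i = 2 * s i) ∧ ∀ k, k + 1 ∈ T → π k = 2 * s (k + 1) := by
  -- The walk is the Lipschitz extension by minima: the truncated differences add up to the distance
  -- from k to {i - 1, i}, and `hgap` says that no such tent undercuts another at its bottom.
  let S : ℕ → Finset ℕ := fun k =>
    insert (2 * m) (T.image fun i => 2 * s i + ((k - i) + (i - 1 - k)))
  have hne : ∀ k, (S k).Nonempty := fun k => Finset.insert_nonempty _ _
  have hm : ∀ k, (S k).min' (hne k) ≤ 2 * m := fun k =>
    Finset.min'_le _ _ (Finset.mem_insert_self _ _)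
  have hle : ∀ k, ∀ i ∈ T, (S k).min' (hne k) ≤ 2 * s i + ((k - i) + (i - 1 - k)) :=
    fun k i hi => Finset.min'_le _ _
      (Finset.mem_insert_of_mem (Finset.mem_image_of_mem _ hi))
  have hcases : ∀ k, (S k).min' (hne k) = 2 * m ∨
      ∃ i ∈ T, (S k).min' (hne k) = 2 * s i + ((k - i) + (i - 1 - k)) := by
    intro k
    have h := Finset.min'_mem (S k) (hne k)
    rcases Finset.mem_insert.1 h with h | h
    · exact Or.inl h
    · obtain ⟨i, hi, h⟩ := Finset.mem_image.1 h
      exact Or.inr ⟨i, hi, h.symm⟩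
  refine ⟨fun k => (S k).min' (hne k), hm, fun k => ⟨?_, ?_⟩, fun i hi => ?_, fun k hk => ?_⟩
  · rcases hcases k with h | ⟨i, hi, h⟩
    · have := hm (k + 1); dsimp only; omega
    · have := hle (k + 1) i hi; dsimp only; omega
  · rcases hcases (k + 1) with h | ⟨i, hi, h⟩
    · have := hm k; dsimp only; omega
    · have := hle k i hi; dsimp only; omega
  · have h1 := hle i i hi
    have h2 := hs i hi
    rcases hcases i with h | ⟨j, hj, h⟩
    · dsimp only; omega
    · dsimp only
      rcases lt_trichotomy i j with hij | rfl | hij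
      · have := hgap i hi j hj hij; omega
      · omega
      · have := hgap j hj i hi hij; omega
  · have h1 := hle k (k + 1) hk
    have h2 := hs (k + 1) hk
    rcases hcases k with h | ⟨j, hj, h⟩
    · dsimp only; omega
    · dsimp only
      rcases lt_trichotomy (k + 1) j with hij | rfl | hij
      · have := hgap (k + 1) hk j hj hij; omega
      · omega
      · have := hgap j hj (k + 1) hk hij; omega

/-! ### Leading the zigzags through prescribed points. -/

/-- A monotone function on a finite set of natural numbers extends to a monotone function which
takes no further values. -/
theorem exists_monotone_extension (S : Finset ℕ) (hS : S.Nonempty) (v : ℕ → ℝ)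
    (hv : MonotoneOn v S) :
    ∃ w : ℕ → ℝ, Monotone w ∧ (∀ i ∈ S, w i = v i) ∧ ∀ j, ∃ i ∈ S, w j = v i := by
  let F : ℕ → Finset ℕ := fun j => S.filter (· ≤ j)
  -- Round j down to S, or up to its minimum if nothing of S lies below.
  let r : ℕ → ℕ := fun j => if h : (F j).Nonempty then (F j).max' h else S.min' hS
  have hr : ∀ j, r j ∈ S := by
    intro j
    by_cases h : (F j).Nonempty
    · simp only [r, dif_pos h]
      exact (Finset.mem_filter.1 (Finset.max'_mem _ h)).1
    · simp only [r, dif_neg h]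
      exact Finset.min'_mem _ _
  have hmono : Monotone r := by
    intro j k hjk
    by_cases h : (F j).Nonempty
    · have hsub : F j ⊆ F k := Finset.monotone_filter_right _ fun i _ h => le_trans h hjk
      simp only [r, dif_pos h, dif_pos (h.mono hsub)]
      exact Finset.max'_subset _ hsub
    · have : r j = S.min' hS := by simp only [r, dif_neg h]
      rw [this]
      exact Finset.min'_le _ _ (hr k)
  refine ⟨fun j => v (r j), fun j k hjk => hv (hr j) (hr k) (hmono hjk), fun i hi => ?_,
    fun j => ⟨r j, hr j, rfl⟩⟩
  have hmem : i ∈ F i := Finset.mem_filter.2 ⟨hi, le_rfl⟩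
  have : r i = i := by
    have hne : (F i).Nonempty := ⟨i, hmem⟩
    have hri : r i = (F i).max' hne := dif_pos hne
    rw [hri]
    exact le_antisymm (Finset.mem_filter.1 (Finset.max'_mem (F i) hne)).2 (Finset.le_max' _ _ hmem)
  simp only [this]

theorem exists_pos_lt_of_finset {ι : Type*} (T : Finset ι) (r : ι → ℝ) (hr : ∀ i ∈ T, 0 < r i) :
    ∃ ε > 0, ∀ i ∈ T, ε < r i := by
  have h : ∀ᶠ ε in nhdsWithin (0 : ℝ) (Set.Ioi 0), ∀ i ∈ T, ε < r i :=
    (Filter.eventually_all_finset T).2 fun i hi =>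
      (Ioo_mem_nhdsGT (hr i hi) : Set.Ioo 0 (r i) ∈ _) |> Filter.mem_of_superset <|
        fun x hx => hx.2
  obtain ⟨ε, h1, h2⟩ := (h.and self_mem_nhdsWithin).exists
  exact ⟨ε, h2, h1⟩

theorem eventually_lt_mul_atTop {α : ℝ} (hα : 0 < α) (β : ℝ) :
    ∀ᶠ D : ℝ in Filter.atTop, β < D * α :=
  (Filter.tendsto_id.atTop_mul_const hα).eventually_gt_atTop β

/-- Points on the line which are grouped into consecutive strips can be separated. -/
theorem exists_separators (T : Finset ℕ) (x : ℕ → ℝ) (s : ℕ → ℕ)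
    (h : ∀ i ∈ T, ∀ j ∈ T, s i < s j → x i < x j) :
    ∃ a g : ℕ → ℝ, (∀ k, a k < g k) ∧ (∀ k, g k < a (k + 1)) ∧
      ∀ i ∈ T, a (s i) < x i ∧ x i < g (s i) := by
  obtain ⟨γ, hγ, hγ'⟩ := exists_pos_lt_of_finset ((T ×ˢ T).filter fun q => s q.1 < s q.2)
    (fun q => x q.2 - x q.1) (by
      intro q hq
      simp only [Finset.mem_filter, Finset.mem_product] at hq
      exact sub_pos.2 (h _ hq.1.1 _ hq.1.2 hq.2))
  obtain ⟨b, hb⟩ : ∃ b : ℝ, ∀ i ∈ T, b + γ ≤ x i := by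
    obtain ⟨c, hc⟩ := (T.image x).bddBelow
    refine ⟨c - γ, fun i hi => ?_⟩
    have := hc (Finset.mem_coe.2 (Finset.mem_image_of_mem x hi))
    linarith
  let S : ℕ → Finset ℝ := fun k => insert b ((T.filter fun i => s i < k).image x)
  have hne : ∀ k, (S k).Nonempty := fun k => Finset.insert_nonempty _ _
  let U : ℕ → ℝ := fun k => (S k).max' (hne k)
  have hU : Monotone U := by
    intro k l hkl
    apply Finset.max'_subset
    apply Finset.insert_subset_insert
    apply Finset.image_subset_image
    exact Finset.monotone_filter_right _ fun i _ h => lt_of_lt_of_le h hkl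
  -- A strictly increasing function into (0, 1): `U` is constant across empty strips, and adding γ *
  -- φ still makes the separators strictly increasing without using up the gap γ.
  let φ : ℝ → ℝ := fun t => 1 - 1 / (t + 2)
  have hφ : ∀ t u : ℝ, 0 ≤ t → t < u → φ t < φ u := by
    intro t u ht htu
    have : 1 / (u + 2) < 1 / (t + 2) := one_div_lt_one_div_of_lt (by linarith) (by linarith)
    simp only [φ]; linarith
  have hφ0 : ∀ t : ℝ, 0 ≤ t → 0 < φ t := by
    intro t ht
    have : 1 / (t + 2) < 1 := by rw [div_lt_one (by linarith)]; linarith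
    simp only [φ]; linarith
  have hφ1 : ∀ t : ℝ, 0 ≤ t → φ t < 1 := by
    intro t ht
    have : 0 < 1 / (t + 2) := by positivity
    simp only [φ]; linarith
  refine ⟨fun k => U k + γ * φ k, fun k => U (k + 1) + γ * φ (k + 1 / 2), fun k => ?_,
    fun k => ?_, fun i hi => ⟨?_, ?_⟩⟩
  · have h1 := hU (Nat.le_succ k)
    have h2 := mul_lt_mul_of_pos_left
      (hφ k (k + 1 / 2) (Nat.cast_nonneg k) (by linarith)) hγ
    exact add_lt_add_of_le_of_lt h1 h2
  · have h2 := mul_lt_mul_of_pos_left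
      (hφ (k + 1 / 2) ((k + 1 : ℕ) : ℝ) (by positivity) (by push_cast; linarith)) hγ
    exact add_lt_add_of_le_of_lt le_rfl h2
  · have h1 : U (s i) + γ ≤ x i := by
      have hm := Finset.max'_mem (S (s i)) (hne (s i))
      rcases Finset.mem_insert.1 hm with hm | hm
      · change (S (s i)).max' _ + γ ≤ x i
        rw [hm]; exact hb i hi
      · obtain ⟨j, hj, hj'⟩ := Finset.mem_image.1 hm
        have hj := Finset.mem_filter.1 hj
        change (S (s i)).max' _ + γ ≤ x i
        rw [← hj']
        have := hγ' (j, i) (by simp [hj.1, hi, hj.2])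
        dsimp only at this
        linarith
    have h2 := mul_lt_mul_of_pos_left (hφ1 (s i) (Nat.cast_nonneg _)) hγ
    dsimp only
    linarith
  · have h1 : x i ≤ U (s i + 1) := Finset.le_max' _ _ (Finset.mem_insert_of_mem
      (Finset.mem_image_of_mem x (Finset.mem_filter.2 ⟨hi, Nat.lt_succ_self _⟩)))
    have h2 := mul_pos hγ (hφ0 (s i + 1 / 2) (by positivity))
    dsimp only
    linarith

/-- Zigzag curves through prescribed points which are monotone inside each strip. -/
theorem exists_zigzagData (T : Finset ℕ) (p : ℕ → ℝ × ℝ) (s : ℕ → ℕ) (a g e : ℕ → ℝ)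
    (hag : ∀ k, a k < g k) (hga : ∀ k, g k < a (k + 1)) (he : ∀ k, e k = 1 ∨ e k = -1)
    (hT : ∀ i ∈ T, a (s i) < (p i).1 ∧ (p i).1 < g (s i))
    (hmono : ∀ i ∈ T, ∀ j ∈ T, i < j → s i = s j → 0 < e (s i) * ((p j).1 - (p i).1)) :
    ∃ Z : ZigzagData, Z.a = a ∧ Z.g = g ∧ Z.e = e ∧
      ∀ i ∈ T, Z.OnPiece (2 * s i) i (p i) := by
  -- The amplitudes are D * θ^k. For large D a steep line through p i is nearly the line from D *
  -- θ^s at `a` through 0 at (p i).1, so it reaches past -D * θ^(s+1) at `g` when θ is below this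
  -- ratio.
  obtain ⟨θ, hθ, hθ'⟩ := exists_pos_lt_of_finset T
    (fun i => (g (s i) - (p i).1) / ((p i).1 - a (s i)))
    (fun i hi => div_pos (sub_pos.2 (hT i hi).2) (sub_pos.2 (hT i hi).1))
  have hθ'' : ∀ i ∈ T, 0 < (g (s i) - (p i).1) - θ * ((p i).1 - a (s i)) := fun i hi =>
    sub_pos.2 ((lt_div_iff₀ (sub_pos.2 (hT i hi).1)).1 (hθ' i hi))
  -- Three demands on D: slopes increase with i within a strip (`ev1`), each point is on the correct
  -- side of its connecting line (`ev2`), and the steep lines drop far enough (`ev3`).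
  have ev1 : ∀ᶠ D : ℝ in Filter.atTop, ∀ i ∈ T, ∀ j ∈ T, i < j → s i = s j →
      ((p i).2 - i) * ((p j).1 - a (s i)) - ((p j).2 - j) * ((p i).1 - a (s i)) <
        D * (θ ^ s i * (e (s i) * ((p j).1 - (p i).1))) := by
    refine (Filter.eventually_all_finset T).2 fun i hi =>
      (Filter.eventually_all_finset T).2 fun j hj => ?_
    by_cases h : i < j ∧ s i = s j
    · filter_upwards [eventually_lt_mul_atTop
        (mul_pos (pow_pos hθ (s i)) (hmono i hi j hj h.1 h.2)) _] with D hD _ _ using hD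
    · exact Filter.Eventually.of_forall fun D h1 h2 => absurd ⟨h1, h2⟩ h
  have ev2 : ∀ᶠ D : ℝ in Filter.atTop, ∀ i ∈ T,
      -(e (s i) * ((p i).2 - i)) < D * θ ^ (s i + 1) :=
    (Filter.eventually_all_finset T).2 fun i hi => eventually_lt_mul_atTop (pow_pos hθ _) _
  have ev3 : ∀ᶠ D : ℝ in Filter.atTop, ∀ i ∈ T,
      e (s i) * ((p i).2 - i) * (g (s i) - a (s i)) <
        D * (θ ^ s i * ((g (s i) - (p i).1) - θ * ((p i).1 - a (s i)))) :=
    (Filter.eventually_all_finset T).2 fun i hi =>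
      eventually_lt_mul_atTop (mul_pos (pow_pos hθ _) (hθ'' i hi)) _
  obtain ⟨D, ⟨⟨h1, h2⟩, h3⟩, hD⟩ :=
    (((ev1.and ev2).and ev3).and (Filter.eventually_gt_atTop 0)).exists
  have hee : ∀ k, e k * e k = 1 := fun k => by rcases he k with h | h <;> simp [h]
  let v : ℕ → ℝ := fun i =>
    ((p i).2 - i - e (s i) * (D * θ ^ s i)) / ((p i).1 - a (s i))
  have hv : ∀ i ∈ T, v i * ((p i).1 - a (s i)) = (p i).2 - i - e (s i) * (D * θ ^ s i) :=
    fun i hi => div_mul_cancel₀ _ (sub_pos.2 (hT i hi).1).ne'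
  have hvmono : ∀ i ∈ T, ∀ j ∈ T, i < j → s i = s j → v i < v j := by
    intro i hi j hj hij hs
    have := h1 i hi j hj hij hs
    have hj1 := (hT j hj).1
    simp only [v]
    rw [← hs] at hj1 ⊢
    rw [div_lt_div_iff₀ (sub_pos.2 (hT i hi).1) (sub_pos.2 hj1)]
    linarith
  have hvsteep : ∀ i ∈ T, e (s i) * (e (s i) * (D * θ ^ s i) + v i * (g (s i) - a (s i))) <
      -(D * θ ^ (s i + 1)) := by
    intro i hi
    have hpos := sub_pos.2 (hT i hi).1
    have h3' := h3 i hi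
    have hv' := hv i hi
    have hee' := hee (s i)
    refine lt_of_mul_lt_mul_right ?_ hpos.le
    have e1 : e (s i) * (e (s i) * (D * θ ^ s i) + v i * (g (s i) - a (s i))) *
        ((p i).1 - a (s i)) = D * θ ^ s i * ((p i).1 - a (s i)) + e (s i) * ((p i).2 - i) *
          (g (s i) - a (s i)) - D * θ ^ s i * (g (s i) - a (s i)) := by
      linear_combination (e (s i) * (g (s i) - a (s i))) * hv' +
        (D * θ ^ s i * ((p i).1 - a (s i)) - D * θ ^ s i * (g (s i) - a (s i))) * hee'
    rw [e1, pow_succ]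
    linarith
  have hw : ∀ k, ∃ w : ℕ → ℝ, Monotone w ∧ (∀ i ∈ T, s i = k → w i = v i) ∧
      ∀ j, e k * (e k * (D * θ ^ k) + w j * (g k - a k)) < -(D * θ ^ (k + 1)) := by
    intro k
    by_cases hk : (T.filter fun i => s i = k).Nonempty
    · obtain ⟨w, hw1, hw2, hw3⟩ := exists_monotone_extension _ hk v (by
        intro i hi j hj hij
        rw [Finset.mem_coe, Finset.mem_filter] at hi hj
        rcases hij.eq_or_lt with rfl | hij
        · exact le_rfl
        · exact (hvmono i hi.1 j hj.1 hij (hi.2.trans hj.2.symm)).le)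
      refine ⟨w, hw1, fun i hi hs => hw2 i (Finset.mem_filter.2 ⟨hi, hs⟩), fun j => ?_⟩
      obtain ⟨i, hi, hij⟩ := hw3 j
      rw [Finset.mem_filter] at hi
      rw [hij]
      have := hvsteep i hi.1
      rwa [hi.2] at this
    -- In a strip without points any sufficiently steep common slope will do.
    · refine ⟨fun _ => -e k * (D * θ ^ k + D * θ ^ (k + 1) + 1) / (g k - a k),
        monotone_const, fun i hi hs => ?_, fun j => ?_⟩
      · exact absurd ⟨i, Finset.mem_filter.2 ⟨hi, hs⟩⟩ hk
      · rw [div_mul_cancel₀ _ (sub_pos.2 (hag k)).ne']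
        have := hee k
        have e1 : e k * (e k * (D * θ ^ k) + -e k * (D * θ ^ k + D * θ ^ (k + 1) + 1)) =
          -(D * θ ^ (k + 1)) - 1 := by linear_combination (-(D * θ ^ (k + 1)) - 1) * this
        rw [e1]; linarith
  choose w hw1 hw2 hw3 using hw
  let Z : ZigzagData :=
    { a := a, g := g, e := e, D := fun k => D * θ ^ k, w := w, a_lt_g := hag, g_lt_a := hga
      sign := he, D_pos := fun k => mul_pos hD (pow_pos hθ k), w_mono := hw1, w_steep := hw3 }
  refine ⟨Z, rfl, rfl, rfl, fun i hi => ?_⟩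
  have hx := hT i hi
  apply Z.station_onPiece hx.1.le hx.2.le
  · change (p i).2 = e (s i) * (D * θ ^ s i) + i + w (s i) i * ((p i).1 - a (s i))
    rw [hw2 (s i) i hi rfl, hv i hi]; ring
  · have e1 : Z.con (s i) i (p i).1 = Z.con (s i) i (Z.g (s i)) -
        Z.conSlope (s i) * (g (s i) - (p i).1) := by
      rw [ZigzagData.con, ZigzagData.con]; ring
    rw [e1, Z.con_g]
    have e2 := mul_nonneg (Z.e_mul_conSlope_nonneg (s i)) (sub_pos.2 hx.2).le
    have e3 := h2 i hi
    have e4 := hee (s i)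
    have e5 : Z.e (s i) * (i - Z.e (s i) * Z.D (s i + 1) -
        Z.conSlope (s i) * (g (s i) - (p i).1)) = e (s i) * i - D * θ ^ (s i + 1) -
          Z.e (s i) * Z.conSlope (s i) * (g (s i) - (p i).1) := by
      change e (s i) * (i - e (s i) * (D * θ ^ (s i + 1)) -
        Z.conSlope (s i) * (g (s i) - (p i).1)) = e (s i) * i - D * θ ^ (s i + 1) -
          e (s i) * Z.conSlope (s i) * (g (s i) - (p i).1)
      linear_combination (-(D * θ ^ (s i + 1))) * e4
    rw [e5]
    change _ ≤ e (s i) * (p i).2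
    linarith

/-! ### Assembling and closing the polygon. -/

/-- A polygon with prescribed corners at the indices in `T`, two of which are the two ends of the
closing edge. -/
theorem ZigzagData.exists_isSimplePolygon (Z : ZigzagData) {n : ℕ} (hn : 3 ≤ n) (T : Finset ℕ)
    (p : ℕ → ℝ × ℝ) (s : ℕ → ℕ) (m : ℕ) (X : ℝ) (h0 : 0 ∈ T) (h1 : n - 1 ∈ T)
    (h2' : n - 2 ∉ T)
    (hs : ∀ i ∈ T, s i ≤ m) (hs1 : s (n - 1) = m)
    (hgap : ∀ i ∈ T, ∀ j ∈ T, i < j →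
      2 * s i + i + 1 ≤ 2 * s j + j ∧ 2 * s j + i + 1 ≤ 2 * s i + j)
    (hp0 : p 0 = (X, 0)) (hp1 : p (n - 1) = (X + 1, 0)) (hX : Z.a m < X)
    (hpT : ∀ i ∈ T, i ≠ 0 → i ≠ n - 1 → (p i).1 ≤ Z.a m) (he : Z.e m = 1)
    (hZ : ∀ i ∈ T, Z.OnPiece (2 * s i) i (p i)) :
    ∃ P : ℕ → ℝ × ℝ, (∀ i ∈ T, P i = p i) ∧ IsSimplePolygon n P := by
  obtain ⟨π, hπm, hπ, hπT, hπT'⟩ := exists_walk T s m hs hgap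
  -- Corner t belongs to the pieces t - 1 and t, so the larger of two neighbouring piece numbers
  -- names a corner common to both.
  let P : ℕ → ℝ × ℝ := fun i => if i ∈ T then p i else Z.corner (max (π (i - 1)) (π i)) i
  have hPT : ∀ i ∈ T, P i = p i := fun i hi => if_pos hi
  have hPn : ∀ i, i ∉ T → P i = Z.corner (max (π (i - 1)) (π i)) i := fun i hi => if_neg hi
  have hcorner : ∀ t q i, t ≤ q → q ≤ t + 1 → Z.OnPiece t i (Z.corner q i) := by
    intro t q i h h'
    obtain rfl | rfl : q = t ∨ q = t + 1 := by omega
    · exact Z.corner_onPiece _ _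
    · exact Z.corner_succ_onPiece _ _
  have on1 : ∀ i, Z.OnPiece (π i) i (P i) := by
    intro i
    by_cases hi : i ∈ T
    · rw [hPT i hi, hπT i hi]; exact hZ i hi
    · rw [hPn i hi]
      apply hcorner
      · exact le_max_right _ _
      · rcases Nat.eq_zero_or_pos i with rfl | h
        · exact absurd h0 hi
        · have := hπ (i - 1)
          rw [Nat.sub_add_cancel h] at this
          exact max_le this.2 (Nat.le_succ _)
  have on2 : ∀ i, Z.OnPiece (π i) (i + 1) (P (i + 1)) := by
    intro i
    by_cases hi : i + 1 ∈ T
    · rw [hPT _ hi, hπT' i hi]; exact hZ _ hi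
    · rw [hPn _ hi]
      apply hcorner
      · exact le_max_left _ _
      · exact max_le (Nat.le_succ _) (hπ i).1
  have hfst : ∀ i, i ≠ 0 → i ≠ n - 1 → (P i).1 ≤ Z.a m := by
    intro i hi hi'
    by_cases h : i ∈ T
    · rw [hPT i h]; exact hpT i h hi hi'
    · rw [hPn i h]; exact Z.corner_fst_le (max_le (hπm _) (hπm _))
  -- The vertex before the last has positive height, so the last edge meets the closing edge, at
  -- height 0, only in `P (n - 1)`. All edges but the first and last stay left of X.
  have hlast : P (n - 2) = (Z.a m, Z.D m + (n - 2 : ℕ)) := by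
    have h3 : π (n - 2) = 2 * m := by
      rw [hπT' (n - 2) (by rwa [show n - 2 + 1 = n - 1 by omega]),
        show n - 2 + 1 = n - 1 by omega, hs1]
    rw [hPn _ h2', h3, max_eq_right (hπm _), ZigzagData.corner, if_pos (by omega),
      show 2 * m / 2 = m by omega, he, one_mul]
  refine ⟨P, hPT, ?_, ?_, ?_⟩
  · exact injective_of_graphs Z.curve_strictMono fun i _ => (on1 i).eq_curve
  · exact edge_edge_of_between Z.curve_strictMono (fun i _ => (on1 i).eq_curve)
      fun i _ z hz => Z.openSegment_between (on1 i) (on2 i) hz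
  · intro i hi z hz hz'
    rw [hPT _ h0, hPT _ h1, hp0, hp1] at hz'
    obtain ⟨u, v, hu, hv, huv, rfl⟩ := hz'
    simp only [Prod.smul_mk, Prod.mk_add_mk, smul_eq_mul] at hz ⊢
    obtain ⟨u', v', hu', hv', huv', h⟩ := hz
    have hx := congrArg Prod.fst h
    have hy := congrArg Prod.snd h
    simp only [Prod.fst_add, Prod.smul_fst, Prod.snd_add, Prod.smul_snd, smul_eq_mul] at hx hy
    obtain rfl : u' = 1 - v' := by linarith
    obtain rfl : u = 1 - v := by linarith
    rcases Nat.eq_zero_or_pos i with rfl | hi0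
    · left
      refine ⟨rfl, ?_⟩
      have h4 := hfst 1 one_ne_zero (by omega)
      rw [zero_add] at h hx
      rw [hPT 0 h0, hp0] at hx h ⊢
      have h5 : v' = 0 := by
        by_contra hne
        have h6 : 0 < v' := lt_of_le_of_ne hv' (Ne.symm hne)
        simp only at hx
        nlinarith
      rw [← h, h5]; simp
    · by_cases hi1 : i + 1 = n - 1
      · right
        refine ⟨hi1, ?_⟩
        have hi2 : i = n - 2 := by omega
        rw [hi1, hPT _ h1, hi2, hlast, hp1] at h hy
        rw [hPT _ h1, hp1]
        have h5 : v' = 1 := by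
          by_contra hne
          have h6 : 0 < 1 - v' := by
            rcases lt_or_eq_of_le hu' with h | h
            · exact h
            · exact absurd (by linarith) hne
          have h7 : 0 < Z.D m + ((n - 2 : ℕ) : ℝ) := add_pos_of_pos_of_nonneg (Z.D_pos m)
            (Nat.cast_nonneg _)
          have h8 := mul_pos h6 h7
          simp only at hy
          linarith
        rw [← h, h5]; simp
      · exfalso
        have h4 := hfst i (by omega) (by omega)
        have h5 := hfst (i + 1) (by omega) hi1
        nlinarith

/-- Points which are monotone inside each strip, and spaced by their strips, can be kept as corners
of a simple polygon. -/
theorem exists_isSimplePolygon {n : ℕ} (hn : 3 ≤ n) (T : Finset ℕ) (p : ℕ → ℝ × ℝ) (s : ℕ → ℕ)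
    (m : ℕ) (inc : ℕ → Prop) (hs : ∀ i ∈ T, s i < m)
    (hsx : ∀ i ∈ T, ∀ j ∈ T, s i < s j → (p i).1 < (p j).1)
    (hinc : ∀ i ∈ T, ∀ j ∈ T, i < j → s i = s j → inc (s i) → (p i).1 < (p j).1)
    (hdec : ∀ i ∈ T, ∀ j ∈ T, i < j → s i = s j → ¬ inc (s i) → (p j).1 < (p i).1)
    (hgap : ∀ i ∈ T, ∀ j ∈ T, i < j →
      2 * s i + i + 1 ≤ 2 * s j + j ∧ 2 * s j + i + 1 ≤ 2 * s i + j)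
    (hend : ∀ i ∈ T, 2 * m + 1 ≤ i ∧ i + (2 * m + 1) ≤ n - 1) :
    ∃ P : ℕ → ℝ × ℝ, (∀ i ∈ T, P i = p i) ∧ IsSimplePolygon n P := by
  classical
  obtain ⟨X, hX⟩ : ∃ X : ℝ, ∀ i ∈ T, (p i).1 < X := by
    obtain ⟨c, hc⟩ := (T.image fun i => (p i).1).bddAbove
    refine ⟨c + 1, fun i hi => ?_⟩
    have := hc (Finset.mem_coe.2 (Finset.mem_image_of_mem _ hi))
    linarith
  -- The ends of the closing edge become two further prescribed points, in the new strip m; it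
  -- counts as increasing because X < X + 1.
  let T' : Finset ℕ := insert 0 (insert (n - 1) T)
  let p' : ℕ → ℝ × ℝ := fun i => if i = 0 then (X, 0) else if i = n - 1 then (X + 1, 0) else p i
  let s' : ℕ → ℕ := fun i => if i = 0 ∨ i = n - 1 then m else s i
  let e : ℕ → ℝ := fun k => if k = m ∨ inc k then 1 else -1
  have hT0 : ∀ i ∈ T, i ≠ 0 ∧ i ≠ n - 1 ∧ i ≠ n - 2 := by
    intro i hi
    have := hend i hi
    have := hs i hi
    omega
  have hpT : ∀ i ∈ T, p' i = p i := fun i hi => by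
    simp only [p', if_neg (hT0 i hi).1, if_neg (hT0 i hi).2.1]
  have hsT : ∀ i ∈ T, s' i = s i := fun i hi =>
    if_neg (not_or.2 ⟨(hT0 i hi).1, (hT0 i hi).2.1⟩)
  have hn0 : n - 1 ≠ 0 := by omega
  have hp0 : p' 0 = (X, 0) := if_pos rfl
  have hp1 : p' (n - 1) = (X + 1, 0) := by simp only [p', if_neg hn0, if_pos]
  have hs0 : s' 0 = m := if_pos (Or.inl rfl)
  have hs1 : s' (n - 1) = m := if_pos (Or.inr rfl)
  have hmem : ∀ i ∈ T', i = 0 ∨ i = n - 1 ∨ i ∈ T := fun i hi => by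
    simpa [T'] using hi
  have hsx' : ∀ i ∈ T', ∀ j ∈ T', s' i < s' j → (p' i).1 < (p' j).1 := by
    intro i hi j hj hij
    rcases hmem i hi with rfl | rfl | hi <;> rcases hmem j hj with rfl | rfl | hj
    · omega
    · omega
    · have := hs j hj; rw [hsT j hj] at hij; omega
    · omega
    · omega
    · have := hs j hj; rw [hsT j hj] at hij; omega
    · rw [hpT i hi, hp0]; exact hX i hi
    · rw [hpT i hi, hp1]; have := hX i hi; simp only; linarith
    · rw [hpT i hi, hpT j hj]; rw [hsT i hi, hsT j hj] at hij; exact hsx i hi j hj hij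
  obtain ⟨a, g, hag, hga, hT⟩ := exists_separators T' (fun i => (p' i).1) s' hsx'
  have he : ∀ k, e k = 1 ∨ e k = -1 := fun k => by simp only [e]; split_ifs <;> simp
  have hmono : ∀ i ∈ T', ∀ j ∈ T', i < j → s' i = s' j →
      0 < e (s' i) * ((p' j).1 - (p' i).1) := by
    intro i hi j hj hij hss
    have hem : e m = 1 := if_pos (Or.inl rfl)
    rcases hmem i hi with rfl | rfl | hi <;> rcases hmem j hj with rfl | rfl | hj
    · omega
    · rw [hs0, hem, hp0, hp1]; norm_num
    · have := hs j hj; rw [hsT j hj] at hss; omega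
    · omega
    · omega
    · have := hs j hj; rw [hsT j hj] at hss; omega
    · omega
    · have := hs i hi; rw [hsT i hi] at hss; omega
    · rw [hsT i hi, hsT j hj] at hss
      rw [hpT i hi, hpT j hj, hsT i hi]
      by_cases h : inc (s i)
      · have h1 : e (s i) = 1 := if_pos (Or.inr h)
        have := hinc i hi j hj hij hss h
        rw [h1]; linarith
      · have h1 : e (s i) = -1 := if_neg (not_or.2 ⟨(hs i hi).ne, h⟩)
        have := hdec i hi j hj hij hss h
        rw [h1]; linarith
  obtain ⟨Z, rfl, rfl, hZe, hZ⟩ := exists_zigzagData T' p' s' a g e hag hga he hT hmono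
  have h0T : 0 ∈ T' := Finset.mem_insert_self _ _
  have h1T : n - 1 ∈ T' := Finset.mem_insert_of_mem (Finset.mem_insert_self _ _)
  have hpoly : ∃ P : ℕ → ℝ × ℝ, (∀ i ∈ T', P i = p' i) ∧ IsSimplePolygon n P := by
    refine Z.exists_isSimplePolygon hn T' p' s' m X h0T h1T ?_ ?_ hs1 ?_
      hp0 hp1 ?_ ?_ (by rw [hZe]; exact if_pos (Or.inl rfl)) hZ
    · intro h
      rcases hmem _ h with h | h | h
      · omega
      · omega
      · exact (hT0 _ h).2.2 rfl
    · intro i hi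
      rcases hmem i hi with rfl | rfl | hi
      · exact hs0.le
      · exact hs1.le
      · rw [hsT i hi]; exact (hs i hi).le
    · intro i hi j hj hij
      rcases hmem i hi with rfl | rfl | hi <;> rcases hmem j hj with rfl | rfl | hj
      · omega
      · rw [hs0, hs1]; omega
      · have := hs j hj; have := hend j hj; rw [hsT j hj, hs0]; omega
      · omega
      · omega
      · have := hend j hj; omega
      · omega
      · have := hs i hi; have := hend i hi; rw [hsT i hi, hs1]; omega
      · rw [hsT i hi, hsT j hj]; exact hgap i hi j hj hij
    · have := (hT 0 h0T).1
      rwa [hs0, hp0] at this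
    · intro i hi hi0 hi1
      rcases hmem i hi with rfl | rfl | hi'
      · exact absurd rfl hi0
      · exact absurd rfl hi1
      · have h3 := (hT i hi).2
        rw [hsT i hi'] at h3
        exact h3.le.trans ((hga _).le.trans (Z.a_strictMono.monotone (hs i hi')))
  obtain ⟨P, hP, hP'⟩ := hpoly
  refine ⟨P, fun i hi => ?_, hP'⟩
  rw [hP i (Finset.mem_insert_of_mem (Finset.mem_insert_of_mem hi)), hpT i hi]

/-! ### From simple polygons to plane drawings of the cycle; coordinates. -/

theorem cycleGraph_adj_cases {n : ℕ} (hn : 2 ≤ n) {u v : Fin n}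
    (h : (SimpleGraph.cycleGraph n).Adj u v) :
    (v : ℕ) = u + 1 ∨ (u : ℕ) = v + 1 ∨ ((u : ℕ) = n - 1 ∧ (v : ℕ) = 0) ∨
      ((v : ℕ) = n - 1 ∧ (u : ℕ) = 0) := by
  rw [SimpleGraph.cycleGraph_adj', Fin.val_sub, Fin.val_sub] at h
  have hu := u.2
  have hv := v.2
  have key : ∀ a b : ℕ, a < n → b < n → (n - b + a) % n = 1 →
      a = b + 1 ∨ (b = n - 1 ∧ a = 0) := by
    intro a b ha hb hab
    rcases lt_or_ge a b with h | h
    · rw [Nat.mod_eq_of_lt (by omega)] at hab; omega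
    · rw [show n - b + a = (a - b) + n by omega, Nat.add_mod_right,
        Nat.mod_eq_of_lt (by omega)] at hab
      omega
  rcases h with h | h
  · have := key u v hu hv h; omega
  · have := key v u hv hu h; omega

theorem exists_cycleGraph_adj {n : ℕ} (hn : 2 ≤ n) (u : Fin n) :
    ∃ v, (SimpleGraph.cycleGraph n).Adj u v := by
  obtain ⟨k, rfl⟩ : ∃ k, n = k + 2 := ⟨n - 2, by omega⟩
  exact ⟨u + 1, SimpleGraph.cycleGraph_adj.2 (Or.inr (by simp))⟩

/-- For graphs without isolated vertices, the condition on vertices and edges in the definition of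
plane drawings follows from the condition on pairs of edges. -/
theorem isPlaneDrawing_of_edge_edge {V : Type*} {G : SimpleGraph V} {β : V → Plane}
    (hG : ∀ u, ∃ v, G.Adj u v) (hβ : Function.Injective β)
    (h : ∀ u v x y : V, G.Adj u v → G.Adj x y → s(u, v) ≠ s(x, y) →
      segment ℝ (β u) (β v) ∩ segment ℝ (β x) (β y) ⊆ β '' ({u, v} ∩ {x, y})) :
    IsPlaneDrawing G β where
  injective := hβ
  edge_edge := h
  vertex_edge := by
    intro u v w huv hw
    by_contra hne
    obtain ⟨w', hw'⟩ := hG w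
    have hne' : s(u, v) ≠ s(w, w') := by
      intro he
      have : w ∈ s(u, v) := he ▸ Sym2.mem_mk_left w w'
      exact hne (by simpa using this)
    obtain ⟨z, hz, hzw⟩ := h u v w w' huv hw' hne' ⟨hw, left_mem_segment ℝ _ _⟩
    rw [hβ hzw] at hz
    exact hne (by simpa using hz.1)

/-- A simple polygon is a plane drawing of the cycle, in any linear coordinates. -/
theorem IsSimplePolygon.isPlaneDrawing {n : ℕ} (hn : 3 ≤ n) {P : ℕ → ℝ × ℝ}
    (h : IsSimplePolygon n P) (E : (ℝ × ℝ) ≃ₗ[ℝ] Plane) :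
    IsPlaneDrawing (SimpleGraph.cycleGraph n) fun v : Fin n => E (P v) := by
  have hinj : Function.Injective fun v : Fin n => E (P v) := fun u v huv =>
    Fin.ext (h.injective u u.2 v v.2 (E.injective huv))
  refine isPlaneDrawing_of_edge_edge (exists_cycleGraph_adj (by omega)) hinj ?_
  have hseg : ∀ p q : ℝ × ℝ, ∀ z ∈ segment ℝ (E p) (E q), E.symm z ∈ segment ℝ p q := by
    intro p q z hz
    have := image_segment ℝ (E.symm : Plane →ₗ[ℝ] ℝ × ℝ).toAffineMap (E p) (E q)
    simp only [LinearMap.coe_toAffineMap, LinearEquiv.coe_coe, LinearEquiv.symm_apply_apply]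
      at this
    rw [← this]
    exact ⟨z, hz, rfl⟩
  -- every edge is `i, i + 1` or the closing edge, up to orientation
  have hedge : ∀ u v : Fin n, (SimpleGraph.cycleGraph n).Adj u v →
      ∃ i j : Fin n, ((j : ℕ) = i + 1 ∨ ((i : ℕ) = n - 1 ∧ (j : ℕ) = 0)) ∧ s(u, v) = s(i, j) ∧
        segment ℝ (E (P u)) (E (P v)) = segment ℝ (E (P i)) (E (P j)) ∧
        ({u, v} : Set (Fin n)) = {i, j} := by
    intro u v huv
    rcases cycleGraph_adj_cases (by omega) huv with h | h | h | h
    · exact ⟨u, v, Or.inl h, rfl, rfl, rfl⟩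
    · exact ⟨v, u, Or.inl h, Sym2.eq_swap, segment_symm _ _ _, Set.pair_comm _ _⟩
    · exact ⟨u, v, Or.inr h, rfl, rfl, rfl⟩
    · exact ⟨v, u, Or.inr h, Sym2.eq_swap, segment_symm _ _ _, Set.pair_comm _ _⟩
  intro u v x y huv hxy hne z hz
  obtain ⟨i, j, hij, h1, h2, h3⟩ := hedge u v huv
  obtain ⟨k, l, hkl, h1', h2', h3'⟩ := hedge x y hxy
  rw [h2, h2'] at hz
  rw [h3, h3']
  rw [h1, h1'] at hne
  have hz1 := hseg _ _ z hz.1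
  have hz2 := hseg _ _ z hz.2
  have hzE : ∀ w : Fin n, E.symm z = P w → E (P w) = z := fun w hw => by
    rw [← hw, LinearEquiv.apply_symm_apply]
  have hi := i.2
  have hj := j.2
  have hk := k.2
  have hl := l.2
  rcases hij with hij | hij <;> rcases hkl with hkl | hkl
  · rw [hij] at hz1
    rw [hkl] at hz2
    rcases lt_trichotomy (i : ℕ) k with hik | hik | hik
    · obtain ⟨h4, h5⟩ := h.edge_edge i k hik (by omega) _ hz1 hz2
      have h6 : k = j := Fin.ext (by omega)
      exact ⟨k, ⟨by simp [h6], by simp⟩, hzE k h5⟩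
    · have h6 : i = k := Fin.ext hik
      have h7 : j = l := Fin.ext (by omega)
      exact absurd (by rw [h6, h7]) hne
    · obtain ⟨h4, h5⟩ := h.edge_edge k i hik (by omega) _ hz2 hz1
      have h6 : i = l := Fin.ext (by omega)
      exact ⟨i, ⟨by simp, by simp [h6]⟩, hzE i h5⟩
  · rw [hij] at hz1
    rw [hkl.1, hkl.2] at hz2
    rcases h.edge_closing i (by omega) _ hz1 hz2 with ⟨h4, h5⟩ | ⟨h4, h5⟩
    · have h6 : i = l := Fin.ext (by omega)
      exact ⟨i, ⟨by simp, by simp [h6]⟩, hzE i (by rw [h5, h4])⟩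
    · have h6 : j = k := Fin.ext (by omega)
      exact ⟨j, ⟨by simp, by simp [h6]⟩, hzE j (by rw [h5, hij, h4])⟩
  · rw [hkl] at hz2
    rw [hij.1, hij.2] at hz1
    rcases h.edge_closing k (by omega) _ hz2 hz1 with ⟨h4, h5⟩ | ⟨h4, h5⟩
    · have h6 : k = j := Fin.ext (by omega)
      exact ⟨k, ⟨by simp [h6], by simp⟩, hzE k (by rw [h5, h4])⟩
    · have h6 : l = i := Fin.ext (by omega)
      exact ⟨l, ⟨by simp [h6], by simp⟩, hzE l (by rw [h5, hkl, h4])⟩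
  · have h6 : i = k := Fin.ext (by omega)
    have h7 : j = l := Fin.ext (by omega)
    exact absurd (by rw [h6, h7]) hne

/-- Finitely many points of the plane have pairwise distinct abscissas in suitable linear
coordinates. -/
theorem exists_linearEquiv_fst_injective {ι : Type*} [Finite ι] {δ : ι → Plane}
    (hδ : Function.Injective δ) :
    ∃ E : (ℝ × ℝ) ≃ₗ[ℝ] Plane, Function.Injective fun i => (E.symm (δ i)).1 := by
  have : Fintype ι := Fintype.ofFinite ι
  -- A shear with parameter t gives two points the same abscissa only for one of finitely many
  -- ratios, unless they agree in the second coordinate.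
  obtain ⟨t, ht⟩ := Infinite.exists_notMem_finset
    ((Finset.univ : Finset (ι × ι)).image fun q => -(δ q.1 0 - δ q.2 0) / (δ q.1 1 - δ q.2 1))
  let E : Plane ≃ₗ[ℝ] ℝ × ℝ :=
    { toFun := fun q => (q 0 + t * q 1, q 1)
      map_add' := fun p q => by ext <;> simp; ring
      map_smul' := fun c q => by ext <;> simp; ring
      invFun := fun q => !₂[q.1 - t * q.2, q.2]
      left_inv := fun q => by ext k; fin_cases k <;> simp
      right_inv := fun q => by ext <;> simp }
  refine ⟨E.symm, fun i j hij => ?_⟩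
  have hij' : δ i 0 + t * δ i 1 = δ j 0 + t * δ j 1 := hij
  by_contra hne
  by_cases h : δ i 1 = δ j 1
  · refine hne (hδ ?_)
    ext k
    fin_cases k
    · change δ i 0 = δ j 0
      rw [h] at hij'; linarith
    · exact h
  · apply ht
    refine Finset.mem_image.2 ⟨(i, j), Finset.mem_univ _, ?_⟩
    have := sub_ne_zero.2 h
    simp only
    rw [div_eq_iff this]
    linarith

/-! ### Monotone sequences, random selection and conflict counting. -/

/-- A sequence of at most `A * (A + 1) / 2` distinct reals splits into `A` monotone
subsequences. -/
theorem exists_monotone_coloring (x : ℕ → ℝ) (A : ℕ) (F : Finset ℕ) (hx : Set.InjOn x F)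
    (hF : F.card ≤ A * (A + 1) / 2) :
    ∃ col : ℕ → ℕ, (∀ i ∈ F, col i < A) ∧
      ∀ c, StrictMonoOn x {i | i ∈ F ∧ col i = c} ∨ StrictAntiOn x {i | i ∈ F ∧ col i = c} := by
  classical
  induction A generalizing F with
  | zero =>
    have : F = ∅ := by simpa using hF
    subst this
    exact ⟨fun _ => 0, by simp, fun c => Or.inl (by simp [StrictMonoOn])⟩
  | succ A ih =>
    -- An increasing sequence of length at least A + 1 is removed as one colour class, which leaves
    -- at most A(A+1)/2 points for the induction.
    by_cases h : ∃ G ⊆ F, StrictMonoOn x G ∧ A + 1 ≤ G.card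
    · obtain ⟨G, hGF, hG, hcard⟩ := h
      have h1 : (F \ G).card ≤ A * (A + 1) / 2 := by
        rw [Finset.card_sdiff_of_subset hGF]
        have : (A + 1) * (A + 1 + 1) / 2 = A * (A + 1) / 2 + (A + 1) := by
          rw [show (A + 1) * (A + 1 + 1) = A * (A + 1) + (A + 1) * 2 by ring,
            Nat.add_mul_div_right _ _ two_pos]
        omega
      obtain ⟨col, hc1, hc2⟩ := ih (F \ G) (hx.mono (by simp)) h1
      refine ⟨fun i => if i ∈ G then A else col i, fun i hi => ?_, fun c => ?_⟩
      · dsimp only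
        split_ifs with hiG
        · omega
        · have := hc1 i (Finset.mem_sdiff.2 ⟨hi, hiG⟩); omega
      · have hlt : ∀ i ∈ F, i ∉ G → col i < A := fun i hi hiG =>
          hc1 i (Finset.mem_sdiff.2 ⟨hi, hiG⟩)
        by_cases hcA : c = A
        · left
          apply hG.mono
          rintro i ⟨hi, hic⟩
          by_contra hiG
          have hiG' : i ∉ G := hiG
          dsimp only at hic
          rw [if_neg hiG'] at hic
          have := hlt i hi hiG'
          omega
        · have hsub : {i | i ∈ F ∧ (if i ∈ G then A else col i) = c} ⊆
              {i | i ∈ F \ G ∧ col i = c} := by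
            rintro i ⟨hi, hic⟩
            by_cases hiG : i ∈ G
            · rw [if_pos hiG] at hic; exact absurd hic.symm hcA
            · rw [if_neg hiG] at hic; exact ⟨Finset.mem_sdiff.2 ⟨hi, hiG⟩, hic⟩
          exact (hc2 c).imp (fun h => h.mono hsub) (fun h => h.mono hsub)
    · push Not at h
      -- Otherwise colour i by the length of a longest increasing sequence ending at i; equal
      -- lengths force a decrease.
      let fam : ℕ → Finset (Finset ℕ) := fun i =>
        F.powerset.filter fun G => StrictMonoOn x G ∧ i ∈ G ∧ ∀ j ∈ G, j ≤ i
      let len : ℕ → ℕ := fun i => (fam i).sup Finset.card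
      have hlen : ∀ i, len i ≤ A := by
        intro i
        apply Finset.sup_le
        intro G hG
        rw [Finset.mem_filter, Finset.mem_powerset] at hG
        have := h G hG.1 hG.2.1
        omega
      refine ⟨len, fun i hi => Nat.lt_succ_of_le (hlen i), fun c => Or.inr ?_⟩
      rintro i ⟨hi, hic⟩ j ⟨hj, hjc⟩ hij
      by_contra hlt
      have hxij : x i < x j := by
        rcases lt_or_eq_of_le (not_lt.1 hlt) with h | h
        · exact h
        · exact absurd (hx hi hj h) hij.ne
      have hne : (fam i).Nonempty := ⟨{i}, by
        simp only [fam, Finset.mem_filter, Finset.mem_powerset, Finset.singleton_subset_iff]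
        exact ⟨hi, by simp [StrictMonoOn], by simp, by simp⟩⟩
      obtain ⟨G, hG, hGc⟩ := Finset.exists_mem_eq_sup _ hne Finset.card
      rw [Finset.mem_filter, Finset.mem_powerset] at hG
      obtain ⟨hGF, hGm, hiG, hGi⟩ := hG
      have hjG : j ∉ G := fun hjG => absurd (hGi j hjG) (by omega)
      have hmem : insert j G ∈ fam j := by
        rw [Finset.mem_filter, Finset.mem_powerset]
        refine ⟨Finset.insert_subset hj hGF, ?_, Finset.mem_insert_self _ _, ?_⟩
        · intro k hk l hl hkl
          rw [Finset.mem_coe, Finset.mem_insert] at hk hl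
          rcases hk with rfl | hk <;> rcases hl with rfl | hl
          · omega
          · have := hGi l hl; omega
          · exact (hGm.monotoneOn hk hiG (hGi k hk)).trans_lt hxij
          · exact hGm hk hl hkl
        · intro k hk
          rcases Finset.mem_insert.1 hk with rfl | hk
          · exact le_rfl
          · exact (hGi k hk).trans hij.le
      have h1 : (insert j G).card ≤ len j := Finset.le_sup (f := Finset.card) hmem
      rw [Finset.card_insert_of_notMem hjG] at h1
      have h2 : len i = G.card := hGc
      omega

/-- The number of functions with prescribed values on a set of arguments. -/
theorem card_filter_eq_on_mul {m A : ℕ} (R : Finset (Fin m)) (c : Fin m → Fin A) :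
    (Finset.univ.filter fun χ : Fin m → Fin A => ∀ t ∈ R, χ t = c t).card * A ^ R.card =
      A ^ m := by
  have h1 : (Finset.univ.filter fun χ : Fin m → Fin A => ∀ t ∈ R, χ t = c t) =
      Fintype.piFinset fun t => if t ∈ R then {c t} else Finset.univ := by
    ext χ
    simp only [Finset.mem_filter, Finset.mem_univ, true_and, Fintype.mem_piFinset]
    refine forall_congr' fun t => ?_
    split_ifs with h <;> simp [h]
  have h2 : ∀ t, (if t ∈ R then {c t} else (Finset.univ : Finset (Fin A))).card =
      if t ∈ R then 1 else A := by
    intro t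
    split_ifs <;> simp
  rw [h1, Fintype.card_piFinset]
  simp only [h2]
  rw [Finset.prod_ite, Finset.prod_const_one, one_mul, Finset.prod_const, ← pow_add]
  congr 1
  have h3 : (Finset.univ.filter fun t => t ∉ R) = Rᶜ := by ext; simp
  rw [h3, Finset.card_compl, Fintype.card_fin]
  have := Finset.card_le_univ R
  rw [Fintype.card_fin] at this
  omega

/-- Choose one colour for each strip and delete one point of each conflicting pair: on average
many points remain. -/
theorem exists_selection (I : Finset ℕ) (s col : ℕ → ℕ) (m A : ℕ) (hA : 0 < A)
    (hs : ∀ i ∈ I, s i < m) (hcol : ∀ i ∈ I, col i < A) (Q : Finset (ℕ × ℕ))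
    (hQ : ∀ q ∈ Q, q.1 ∈ I ∧ q.2 ∈ I ∧ s q.1 ≠ s q.2) :
    ∃ χ : ℕ → ℕ, ∃ S ⊆ I, (∀ i ∈ S, col i = χ (s i)) ∧ (∀ q ∈ Q, ¬ (q.1 ∈ S ∧ q.2 ∈ S)) ∧
      (I.card : ℝ) / A - Q.card / (A : ℝ) ^ 2 ≤ S.card := by
  classical
  -- For uniform χ a point is kept with probability 1/A, and a pair from different strips with
  -- probability 1/A^2; both are obtained by counting the functions χ.
  let K (χ : Fin m → Fin A) (i : ℕ) : Prop := ∃ h : s i < m, (χ ⟨s i, h⟩ : ℕ) = col i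
  have hA' : (0 : ℝ) < A := by exact_mod_cast hA
  have c1 : ∀ i ∈ I, ((Finset.univ.filter fun χ : Fin m → Fin A => K χ i).card : ℝ) * A =
      (A : ℝ) ^ m := by
    intro i hi
    have h := card_filter_eq_on_mul {⟨s i, hs i hi⟩} (fun _ : Fin m => ⟨col i, hcol i hi⟩)
    rw [Finset.card_singleton, pow_one] at h
    rw [← Nat.cast_pow, ← h, Nat.cast_mul]
    congr 3
    ext χ
    simp only [Finset.mem_filter, Finset.mem_univ, true_and, Finset.mem_singleton, forall_eq, K]
    exact ⟨fun ⟨_, h⟩ => Fin.ext h, fun h => ⟨hs i hi, congrArg Fin.val h⟩⟩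
  have c2 : ∀ q ∈ Q, ((Finset.univ.filter fun χ : Fin m → Fin A => K χ q.1 ∧ K χ q.2).card : ℝ) *
      (A : ℝ) ^ 2 = (A : ℝ) ^ m := by
    intro q hq
    obtain ⟨h1, h2, h3⟩ := hQ q hq
    have hne : (⟨s q.1, hs _ h1⟩ : Fin m) ≠ ⟨s q.2, hs _ h2⟩ := fun h =>
      h3 (congrArg Fin.val h)
    have h := card_filter_eq_on_mul {⟨s q.1, hs _ h1⟩, ⟨s q.2, hs _ h2⟩}
      (fun t : Fin m => if t = ⟨s q.1, hs _ h1⟩ then ⟨col q.1, hcol _ h1⟩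
        else ⟨col q.2, hcol _ h2⟩)
    rw [Finset.card_pair hne] at h
    rw [← Nat.cast_pow, ← Nat.cast_pow, ← h, Nat.cast_mul]
    congr 3
    ext χ
    simp only [Finset.mem_filter, Finset.mem_univ, true_and, Finset.mem_insert,
      Finset.mem_singleton, forall_eq_or_imp, forall_eq, if_true, if_neg hne.symm, K]
    exact ⟨fun ⟨⟨_, h⟩, ⟨_, h'⟩⟩ => ⟨Fin.ext h, Fin.ext h'⟩, fun ⟨h, h'⟩ =>
      ⟨⟨hs _ h1, congrArg Fin.val h⟩, ⟨hs _ h2, congrArg Fin.val h'⟩⟩⟩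
  let IK (χ : Fin m → Fin A) := I.filter (K χ)
  let QK (χ : Fin m → Fin A) := Q.filter fun q => K χ q.1 ∧ K χ q.2
  have d1 : (∑ χ : Fin m → Fin A, ((IK χ).card : ℝ)) * A = I.card * (A : ℝ) ^ m := by
    have : ∑ χ : Fin m → Fin A, (IK χ).card =
        ∑ i ∈ I, (Finset.univ.filter fun χ : Fin m → Fin A => K χ i).card :=
      Finset.sum_card_bipartiteAbove_eq_sum_card_bipartiteBelow K
    rw [← Nat.cast_sum, this, Nat.cast_sum, Finset.sum_mul, Finset.sum_congr rfl c1,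
      Finset.sum_const, nsmul_eq_mul]
  have d2 : (∑ χ : Fin m → Fin A, ((QK χ).card : ℝ)) * (A : ℝ) ^ 2 =
      Q.card * (A : ℝ) ^ m := by
    have : ∑ χ : Fin m → Fin A, (QK χ).card =
        ∑ q ∈ Q, (Finset.univ.filter fun χ : Fin m → Fin A => K χ q.1 ∧ K χ q.2).card :=
      Finset.sum_card_bipartiteAbove_eq_sum_card_bipartiteBelow
        fun χ (q : ℕ × ℕ) => K χ q.1 ∧ K χ q.2
    rw [← Nat.cast_sum, this, Nat.cast_sum, Finset.sum_mul, Finset.sum_congr rfl c2,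
      Finset.sum_const, nsmul_eq_mul]
  have hne : (Finset.univ : Finset (Fin m → Fin A)).Nonempty :=
    ⟨fun _ => ⟨0, hA⟩, Finset.mem_univ _⟩
  obtain ⟨χ, -, hχ⟩ : ∃ χ ∈ (Finset.univ : Finset (Fin m → Fin A)),
      (I.card : ℝ) / A - Q.card / (A : ℝ) ^ 2 ≤ ((IK χ).card : ℝ) - (QK χ).card := by
    apply Finset.exists_le_of_sum_le hne
    rw [Finset.sum_const, Finset.sum_sub_distrib, Finset.card_univ, Fintype.card_fun,
      Fintype.card_fin, Fintype.card_fin, nsmul_eq_mul, Nat.cast_pow]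
    rw [eq_div_of_mul_eq hA'.ne' d1, eq_div_of_mul_eq (by positivity) d2]
    apply le_of_eq
    ring
  let S := IK χ \ (QK χ).image Prod.fst
  have hK : ∀ i ∈ S, K χ i := fun i hi => (Finset.mem_filter.1 (Finset.mem_sdiff.1 hi).1).2
  refine ⟨fun t => if h : t < m then χ ⟨t, h⟩ else 0, S,
    Finset.sdiff_subset.trans (Finset.filter_subset _ _), fun i hi => ?_, fun q hq hqS => ?_,
    hχ.trans ?_⟩
  · obtain ⟨h, h'⟩ := hK i hi
    simp only [dif_pos h, h']
  · apply (Finset.mem_sdiff.1 hqS.1).2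
    exact Finset.mem_image_of_mem _ (Finset.mem_filter.2 ⟨hq, hK _ hqS.1, hK _ hqS.2⟩)
  · have h1 : (IK χ).card ≤ S.card + ((QK χ).image Prod.fst).card := by
      have : (IK χ).card - ((QK χ).image Prod.fst).card ≤ S.card :=
        Finset.le_card_sdiff ((QK χ).image Prod.fst) (IK χ)
      omega
    have h2 : ((QK χ).image Prod.fst).card ≤ (QK χ).card := Finset.card_image_le
    have h3 : ((IK χ).card : ℝ) ≤ S.card + (QK χ).card := by exact_mod_cast h1.trans (by omega)
    linarith

/-- The summand is the largest distance from strip t to one of the 2h strips; the terms for t and t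
+ h add up to 3h - 1. -/
theorem sum_max_reflect (h : ℕ) :
    ∑ t ∈ Finset.range (2 * h), max t (2 * h - 1 - t) = h * (3 * h - 1) := by
  rw [two_mul, Finset.sum_range_add, ← Finset.sum_add_distrib]
  rw [Finset.sum_congr rfl (g := fun _ => 3 * h - 1), Finset.sum_const, Finset.card_range,
    smul_eq_mul]
  intro t ht
  rw [Finset.mem_range] at ht
  omega

/-- The number of pairs of indices which are close to each other compared with the distance of
their strips. -/
theorem card_conflicts_le (I : Finset ℕ) (s : ℕ → ℕ) (h N : ℕ) (hs : ∀ i ∈ I, s i < 2 * h)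
    (hN : ∀ t, (I.filter fun i => s i = t).card ≤ N) :
    ((I ×ˢ I).filter fun q => q.1 < q.2 ∧ s q.1 ≠ s q.2 ∧
      (q.2 ≤ q.1 + 2 * (s q.1 - s q.2) ∨ q.2 ≤ q.1 + 2 * (s q.2 - s q.1))).card ≤
      N * (2 * (h * (3 * h - 1))) := by
  set Q := (I ×ˢ I).filter fun q => q.1 < q.2 ∧ s q.1 ≠ s q.2 ∧
      (q.2 ≤ q.1 + 2 * (s q.1 - s q.2) ∨ q.2 ≤ q.1 + 2 * (s q.2 - s q.1)) with hQ
  -- Of the two truncated differences one vanishes and the other is the strip distance, so the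
  -- partners of i lie among the `r (s i)` indices after it.
  let r : ℕ → ℕ := fun t => 2 * max t (2 * h - 1 - t)
  have h1 : Q.card ≤ (I.sigma fun i => Finset.Ioc i (i + r (s i))).card := by
    apply Finset.card_le_card_of_injOn (fun q => (⟨q.1, q.2⟩ : Σ _ : ℕ, ℕ))
    · intro q hq
      rw [Finset.mem_coe, hQ, Finset.mem_filter, Finset.mem_product] at hq
      rw [Finset.mem_coe, Finset.mem_sigma, Finset.mem_Ioc]
      have := hs _ hq.1.1
      have := hs _ hq.1.2
      refine ⟨hq.1.1, hq.2.1, ?_⟩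
      simp only [r]
      omega
    · rintro ⟨a, b⟩ _ ⟨c, d⟩ _ heq
      simpa using heq
  rw [Finset.card_sigma] at h1
  have h2 : ∑ i ∈ I, (Finset.Ioc i (i + r (s i))).card =
      ∑ t ∈ Finset.range (2 * h), ∑ i ∈ I with s i = t, r (s i) := by
    rw [Finset.sum_fiberwise_of_maps_to fun i hi => Finset.mem_range.2 (hs i hi)]
    simp
  rw [h2] at h1
  refine h1.trans ?_
  rw [← sum_max_reflect, Finset.mul_sum, Finset.mul_sum]
  apply Finset.sum_le_sum
  intro t _
  rw [Finset.sum_congr rfl (g := fun _ => r t) (by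
    intro i hi; rw [(Finset.mem_filter.1 hi).2]), Finset.sum_const, smul_eq_mul]
  exact Nat.mul_le_mul_right _ (hN t)

/-! ### Bounds for the fix numbers and division into strips. -/

theorem ncard_le_fixAt {V : Type*} [Fintype V] {G : SimpleGraph V} {β δ : V → Plane}
    (hβ : IsPlaneDrawing G β) : {v : V | β v = δ v}.ncard ≤ fixAt G δ := by
  refine le_csSup ⟨Fintype.card V, ?_⟩ ⟨β, hβ, rfl⟩
  rintro k ⟨β', -, rfl⟩
  rw [← Nat.card_eq_fintype_card]
  exact Set.ncard_le_card _

/-- An injective placement has to be exhibited, since the infimum of the empty set of naturals would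
be 0. -/
theorem le_fixNumber {V : Type*} [Fintype V] {G : SimpleGraph V} {r : ℝ}
    (h : ∀ δ : V → Plane, Function.Injective δ → r ≤ fixAt G δ) : r ≤ fixNumber G := by
  have hne : {k : ℕ | ∃ δ : V → Plane, Function.Injective δ ∧ k = fixAt G δ}.Nonempty := by
    let φ := Fintype.equivFin V
    refine ⟨_, fun v => !₂[((φ v : ℕ) : ℝ), 0], fun u v huv => ?_, rfl⟩
    have h0 := congrArg (fun q : Plane => q 0) huv
    simp only [Matrix.cons_val_zero, Nat.cast_inj] at h0
    exact φ.injective (Fin.ext h0)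
  obtain ⟨δ, hδ, hk⟩ := Nat.sInf_mem hne
  rw [fixNumber, hk]
  exact h δ hδ

/-- Consecutive groups of `N` indices, in the order of their values, form strips. -/
theorem exists_strips (n N : ℕ) (hN : 0 < N) (x : ℕ → ℝ) (hx : Set.InjOn x (Set.Iio n)) :
    ∃ s : ℕ → ℕ, (∀ i < n, s i < (n - 1) / N + 1) ∧
      (∀ i < n, ∀ j < n, s i < s j → x i < x j) ∧
      ∀ t, ((Finset.range n).filter fun i => s i = t).card ≤ N := by
  classical
  -- The rank of i by abscissa; strips are blocks of N consecutive ranks.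
  let ρ : ℕ → ℕ := fun i => ((Finset.range n).filter fun j => x j < x i).card
  have hmono : ∀ i j, x i ≤ x j → ρ i ≤ ρ j := fun i j hij =>
    Finset.card_le_card (Finset.monotone_filter_right _ fun k _ hk => hk.trans_le hij)
  have hlt : ∀ i j, i < n → x i < x j → ρ i < ρ j := by
    intro i j hi hij
    apply Finset.card_lt_card
    refine Finset.ssubset_iff_subset_ne.2
      ⟨Finset.monotone_filter_right _ fun k _ hk => hk.trans hij, fun heq => ?_⟩
    have : i ∈ (Finset.range n).filter fun k => x k < x j :=
      Finset.mem_filter.2 ⟨Finset.mem_range.2 hi, hij⟩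
    rw [← heq] at this
    exact lt_irrefl _ (Finset.mem_filter.1 this).2
  have hρn : ∀ i < n, ρ i < n := by
    intro i hi
    have : ρ i < (Finset.range n).card := by
      apply Finset.card_lt_card
      refine Finset.ssubset_iff_subset_ne.2 ⟨Finset.filter_subset _ _, fun heq => ?_⟩
      have := Finset.mem_range.2 hi
      rw [← heq] at this
      exact lt_irrefl _ (Finset.mem_filter.1 this).2
    rwa [Finset.card_range] at this
  have hinj : ∀ i < n, ∀ j < n, ρ i = ρ j → i = j := by
    intro i hi j hj hij
    apply hx hi hj
    rcases lt_trichotomy (x i) (x j) with h | h | h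
    · have := hlt i j hi h; omega
    · exact h
    · have := hlt j i hj h; omega
  refine ⟨fun i => ρ i / N, fun i hi => ?_, fun i _ j _ hij => ?_, fun t => ?_⟩
  · have := hρn i hi
    exact Nat.lt_succ_of_le (Nat.div_le_div_right (by omega))
  · by_contra h
    exact absurd (Nat.div_le_div_right (c := N) (hmono j i (not_lt.1 h))) (not_le.2 hij)
  · have : ((Finset.range n).filter fun i => ρ i / N = t).card ≤
        (Finset.Ico (t * N) (t * N + N)).card := by
      apply Finset.card_le_card_of_injOn ρ
      · intro i hi
        rw [Finset.mem_coe, Finset.mem_filter] at hi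
        rw [Finset.mem_coe, Finset.mem_Ico]
        have := Nat.div_add_mod (ρ i) N
        have h2 := Nat.mod_lt (ρ i) hN
        rw [hi.2, mul_comm] at this
        omega
      · intro i hi j hj hij
        rw [Finset.mem_coe, Finset.mem_filter, Finset.mem_range] at hi hj
        exact hinj i hi.1 j hj.1 hij
    simpa using this

/-! ### The bound with parameters and its optimisation. -/

/-- The lower bound obtained from `2 * h` strips, each of which splits into `A` monotone
sequences. -/
theorem le_fixAt_cycleGraph {n h A : ℕ} (hn : 3 ≤ n) (hA : 0 < A)
    (hnA : n ≤ 2 * h * (A * (A + 1) / 2)) {δ : Fin n → Plane} (hδ : Function.Injective δ) :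
    ((n : ℝ) - 8 * h - 2) / A -
        ((A * (A + 1) / 2 * (2 * (h * (3 * h - 1))) : ℕ) : ℝ) / (A : ℝ) ^ 2 ≤
      fixAt (SimpleGraph.cycleGraph n) δ := by
  classical
  obtain ⟨E, hE⟩ := exists_linearEquiv_fst_injective hδ
  let p : ℕ → ℝ × ℝ := fun i => if h : i < n then E.symm (δ ⟨i, h⟩) else 0
  have hp : ∀ v : Fin n, p v = E.symm (δ v) := fun v => dif_pos v.2
  let x : ℕ → ℝ := fun i => (p i).1
  have hx : Set.InjOn x (Set.Iio n) := by
    intro i hi j hj hij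
    have h1 : (p ((⟨i, hi⟩ : Fin n) : ℕ)).1 = (p ((⟨j, hj⟩ : Fin n) : ℕ)).1 := hij
    rw [hp, hp] at h1
    exact congrArg Fin.val (hE h1)
  set N := A * (A + 1) / 2 with hNdef
  have hN : 0 < N := Nat.div_pos (by nlinarith) two_pos
  obtain ⟨s, hs, hsx, hsN⟩ := exists_strips n N hN x hx
  have hs' : ∀ i < n, s i < 2 * h := by
    intro i hi
    refine lt_of_lt_of_le (hs i hi) ?_
    rw [Nat.succ_le_iff, Nat.div_lt_iff_lt_mul hN]
    omega
  have hcol : ∀ t, ∃ col : ℕ → ℕ, (∀ i ∈ (Finset.range n).filter (fun i => s i = t), col i < A) ∧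
      ∀ c, StrictMonoOn x {i | i ∈ (Finset.range n).filter (fun i => s i = t) ∧ col i = c} ∨
        StrictAntiOn x {i | i ∈ (Finset.range n).filter (fun i => s i = t) ∧ col i = c} :=
    fun t => exists_monotone_coloring x A _
      (hx.mono fun i hi => by
        rw [Finset.mem_coe, Finset.mem_filter, Finset.mem_range] at hi; exact hi.1) (hsN t)
  choose col hcol1 hcol2 using hcol
  -- At each end 4h + 1 indices are given up, so that the path has time to walk from and back to the
  -- extra strip.
  let I := Finset.Ico (2 * (2 * h) + 1) (n - 1 - 2 * (2 * h))
  have hI : ∀ i ∈ I, i < n := fun i hi => by rw [Finset.mem_Ico] at hi; omega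
  let Q := (I ×ˢ I).filter fun q => q.1 < q.2 ∧ s q.1 ≠ s q.2 ∧
      (q.2 ≤ q.1 + 2 * (s q.1 - s q.2) ∨ q.2 ≤ q.1 + 2 * (s q.2 - s q.1))
  have hQ : Q.card ≤ N * (2 * (h * (3 * h - 1))) :=
    card_conflicts_le I s h N (fun i hi => hs' i (hI i hi)) fun t =>
      (Finset.card_le_card (Finset.filter_subset_filter _ fun i hi =>
        Finset.mem_range.2 (hI i hi))).trans (hsN t)
  obtain ⟨χ, S, hSI, hSχ, hSQ, hcard⟩ := exists_selection I s (fun i => col (s i) i) (2 * h) A hA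
    (fun i hi => hs' i (hI i hi)) (fun i hi => hcol1 (s i) i (by simp [hI i hi])) Q (by
      intro q hq
      rw [Finset.mem_filter, Finset.mem_product] at hq
      exact ⟨hq.1.1, hq.1.2, hq.2.2.1⟩)
  let inc : ℕ → Prop := fun t => StrictMonoOn x
    {i | i ∈ (Finset.range n).filter (fun i => s i = t) ∧ col t i = χ t}
  have hSn : ∀ i ∈ S, i < n := fun i hi => hI i (hSI hi)
  have hmem : ∀ i ∈ S, ∀ t, s i = t →
      i ∈ {i | i ∈ (Finset.range n).filter (fun i => s i = t) ∧ col t i = χ t} := by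
    rintro i hi t rfl
    exact ⟨by simp [hSn i hi], hSχ i hi⟩
  obtain ⟨P, hP, hP'⟩ := exists_isSimplePolygon hn S p s (2 * h) inc
    (fun i hi => hs' i (hSn i hi))
    (fun i hi j hj => hsx i (hSn i hi) j (hSn j hj))
    (fun i hi j hj hij hss hinc => hinc (hmem i hi _ rfl) (hmem j hj _ hss.symm) hij)
    (fun i hi j hj hij hss hinc =>
      ((hcol2 (s i) (χ (s i))).resolve_left hinc) (hmem i hi _ rfl) (hmem j hj _ hss.symm) hij)
    (by
      intro i hi j hj hij
      by_cases hss : s i = s j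
      · omega
      · by_contra hc
        refine hSQ (i, j) ?_ ⟨hi, hj⟩
        rw [Finset.mem_filter, Finset.mem_product]
        refine ⟨⟨hSI hi, hSI hj⟩, hij, hss, ?_⟩
        dsimp only
        omega)
    (by
      intro i hi
      have := hSI hi
      rw [Finset.mem_Ico] at this
      omega)
  have hfix := ncard_le_fixAt (δ := δ) (hP'.isPlaneDrawing hn E)
  have hSfix : S.card ≤ {v : Fin n | E (P v) = δ v}.ncard := by
    rw [← Set.ncard_image_of_injective _ Fin.val_injective, ← Set.ncard_coe_finset]
    refine Set.ncard_le_ncard (fun i hi => ?_) (Set.toFinite _)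
    refine ⟨⟨i, hSn i hi⟩, ?_, rfl⟩
    change E (P i) = _
    rw [hP i hi]
    have := hp ⟨i, hSn i hi⟩
    dsimp only at this
    rw [this, LinearEquiv.apply_symm_apply]
  have h1 : (S.card : ℝ) ≤ fixAt (SimpleGraph.cycleGraph n) δ := by
    exact_mod_cast hSfix.trans hfix
  refine le_trans ?_ (hcard.trans h1)
  have hA' : (0 : ℝ) < A := by exact_mod_cast hA
  have h2 : (n : ℝ) - 8 * h - 2 ≤ I.card := by
    have : n ≤ I.card + 8 * h + 2 := by rw [Nat.card_Ico]; omega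
    have : (n : ℝ) ≤ I.card + 8 * h + 2 := by exact_mod_cast this
    linarith
  have h3 : (Q.card : ℝ) ≤ ((N * (2 * (h * (3 * h - 1))) : ℕ) : ℝ) := by exact_mod_cast hQ
  gcongr

/-- With v = u + 1, take h = 8v and A = 125v, so that h A^2 = (50v)^3. The main terms are n/A, about
1000 v^2, and 3h^2 = 192 v^2; of the difference 808 v^2 only 800 v^2 is used. -/
theorem le_fixNumber_cycleGraph {n u : ℕ} (hn : 3 ≤ n) (hu : n ≤ (50 * (u + 1)) ^ 3)
    (hu' : (50 * u) ^ 3 < n) :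
    800 * ((u : ℝ) + 1) ^ 2 - 3003 * (u + 1) ≤ fixNumber (SimpleGraph.cycleGraph n) := by
  refine le_fixNumber fun δ hδ => ?_
  have hdvd : 2 ∣ 125 * (u + 1) * (125 * (u + 1) + 1) := (Nat.even_mul_succ_self _).two_dvd
  have hN := Nat.div_mul_cancel hdvd
  set N := 125 * (u + 1) * (125 * (u + 1) + 1) / 2 with hNdef
  have hnA : n ≤ 2 * (8 * (u + 1)) * N := by
    refine hu.trans ?_
    have : 2 * (8 * (u + 1)) * N = 8 * (u + 1) * (N * 2) := by ring
    rw [this, hN]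
    nlinarith [sq_nonneg u, Nat.zero_le u]
  refine le_trans ?_ (le_fixAt_cycleGraph hn (by omega : 0 < 125 * (u + 1)) hnA hδ)
  rw [← hNdef]
  have hsub : 8 * (u + 1) * (3 * (8 * (u + 1)) - 1) ≤ 8 * (u + 1) * (24 * (u + 1)) :=
    Nat.mul_le_mul_left _ (by omega)
  have h1 : ((N * (2 * (8 * (u + 1) * (3 * (8 * (u + 1)) - 1))) : ℕ) : ℝ) ≤
      125 * (u + 1) * (125 * (u + 1) + 1) * (8 * (u + 1) * (24 * (u + 1))) := by
    have : N * (2 * (8 * (u + 1) * (3 * (8 * (u + 1)) - 1))) ≤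
        125 * (u + 1) * (125 * (u + 1) + 1) * (8 * (u + 1) * (24 * (u + 1))) := by
      rw [← mul_assoc, hN]
      exact Nat.mul_le_mul_left _ hsub
    exact_mod_cast this
  have h2 : ((50 * u : ℝ)) ^ 3 < n := by exact_mod_cast hu'
  push_cast at h1 ⊢
  set v : ℝ := (u : ℝ) + 1 with hv
  have hv1 : 1 ≤ v := by rw [hv]; linarith [Nat.cast_nonneg (α := ℝ) u]
  have hu1 : (u : ℝ) = v - 1 := by rw [hv]; ring
  rw [hu1] at h2
  have hpos : 0 < 125 * v := by linarith
  have h3 : ((N * (2 * (8 * (u + 1) * (3 * (8 * (u + 1)) - 1))) : ℕ) : ℝ) / (125 * v) ^ 2 ≤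
      192 * v ^ 2 + 2 * v := by
    rw [div_le_iff₀ (by positivity)]
    push_cast
    refine h1.trans ?_
    nlinarith [pow_pos (lt_of_lt_of_le one_pos hv1) 3]
  push_cast at h3
  have h4 : 1000 * v ^ 2 - 3000 * v - 1 ≤ ((n : ℝ) - 8 * (8 * v) - 2) / (125 * v) := by
    rw [le_div_iff₀ hpos]
    nlinarith
  nlinarith [sq_nonneg v]

/-- The number 8/25 is 800/50^2, the coefficient of n^(2/3) that the chosen parameters yield. -/
theorem two_rpow_neg_five_thirds_le : (2 : ℝ) ^ (-(5 / 3) : ℝ) ≤ 8 / 25 := by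
  have h : ((2 : ℝ) ^ (-(5 / 3) : ℝ)) ^ 3 = 1 / 32 := by
    rw [← Real.rpow_natCast, ← Real.rpow_mul (by norm_num),
      show (-(5 / 3) : ℝ) * (3 : ℕ) = -(5 : ℕ) by norm_num, Real.rpow_neg (by norm_num),
      Real.rpow_natCast]
    norm_num
  refine le_of_pow_le_pow_left₀ three_ne_zero (by norm_num) ?_
  rw [h]; norm_num

theorem sub_le_fixNumber_cycleGraph {n : ℕ} (hn : 3 ≤ n) :
    (2 : ℝ) ^ (-(5 / 3) : ℝ) * (n : ℝ) ^ (2 / 3 : ℝ) - 6006 * (n : ℝ) ^ (1 / 3 : ℝ) ≤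
      (fixNumber (SimpleGraph.cycleGraph n) : ℝ) := by
  have hex : ∃ u : ℕ, n ≤ (50 * (u + 1)) ^ 3 :=
    ⟨n, by nlinarith [Nat.le_self_pow three_ne_zero (50 * (n + 1))]⟩
  classical
  obtain ⟨u, hu, hu'⟩ : ∃ u : ℕ, n ≤ (50 * (u + 1)) ^ 3 ∧ (50 * u) ^ 3 < n := by
    refine ⟨Nat.find hex, Nat.find_spec hex, ?_⟩
    rcases Nat.eq_zero_or_pos (Nat.find hex) with h | h
    · rw [h]; omega
    · have := Nat.find_min hex (Nat.sub_lt h one_pos)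
      rw [show Nat.find hex - 1 + 1 = Nat.find hex by omega] at this
      exact not_le.1 this
  have key := le_fixNumber_cycleGraph hn hu hu'
  set t : ℝ := (n : ℝ) ^ (1 / 3 : ℝ) with ht
  have hn0 : (0 : ℝ) ≤ n := Nat.cast_nonneg n
  have ht0 : 0 ≤ t := Real.rpow_nonneg hn0 _
  have ht3 : t ^ 3 = n := by
    rw [ht, ← Real.rpow_natCast, ← Real.rpow_mul hn0]; norm_num
  have ht2 : (n : ℝ) ^ (2 / 3 : ℝ) = t ^ 2 := by
    rw [ht, ← Real.rpow_natCast, ← Real.rpow_mul hn0]; norm_num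
  have hu0 : (0 : ℝ) ≤ u := Nat.cast_nonneg u
  have h1 : t ≤ 50 * ((u : ℝ) + 1) := by
    refine le_of_pow_le_pow_left₀ three_ne_zero (by positivity) ?_
    rw [ht3]; exact_mod_cast hu
  have h2 : 50 * (u : ℝ) ≤ t := by
    refine le_of_pow_le_pow_left₀ three_ne_zero ht0 ?_
    rw [ht3]; exact_mod_cast hu'.le
  -- With `h2` this gives u + 1 ≤ 2t, hence the error 3003 (u + 1) is at most 6006 t.
  have h3 : 1 ≤ t := by
    refine le_of_pow_le_pow_left₀ three_ne_zero ht0 ?_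
    rw [ht3, one_pow]; exact_mod_cast (by omega : 1 ≤ n)
  have h4 : t ^ 2 ≤ 2500 * ((u : ℝ) + 1) ^ 2 := by
    have := pow_le_pow_left₀ ht0 h1 2
    linarith [mul_pow (50 : ℝ) ((u : ℝ) + 1) 2]
  have h5 := mul_le_mul two_rpow_neg_five_thirds_le h4 (by positivity) (by norm_num)
  rw [ht2]
  linarith

theorem theorem1 :
    (∃ C : ℝ, ∀ n : ℕ, 3 ≤ n →
      (2 : ℝ) ^ (-(5 / 3) : ℝ) * (n : ℝ) ^ (2 / 3 : ℝ) - C * (n : ℝ) ^ (1 / 3 : ℝ) ≤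
        (fixNumber (SimpleGraph.cycleGraph n) : ℝ)) ∧
    (fun n : ℕ => (n : ℝ) ^ (2 / 3 : ℝ)) =O[Filter.atTop]
      (fun n : ℕ => (fixNumber (SimpleGraph.cycleGraph n) : ℝ)) := by
  refine ⟨⟨6006, fun n hn => sub_le_fixNumber_cycleGraph hn⟩, ?_⟩
  have hc : (0 : ℝ) < 2 ^ (-(5 / 3) : ℝ) := Real.rpow_pos_of_pos two_pos _
  set c : ℝ := 2 ^ (-(5 / 3) : ℝ) with hcdef
  refine Asymptotics.IsBigO.of_bound (2 / c) ?_
  have hlim : Filter.Tendsto (fun n : ℕ => (n : ℝ) ^ (1 / 3 : ℝ)) Filter.atTop Filter.atTop :=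
    (tendsto_rpow_atTop (by norm_num)).comp tendsto_natCast_atTop_atTop
  -- Beyond this threshold for t = n^(1/3) the error 6006 t is at most half of c t^2, which explains
  -- the factor 2/c.
  filter_upwards [hlim.eventually_ge_atTop (2 * 6006 / c), Filter.eventually_ge_atTop 3]
    with n hlarge hn
  have key := sub_le_fixNumber_cycleGraph hn
  rw [← hcdef] at key
  have hn0 : (0 : ℝ) ≤ n := Nat.cast_nonneg n
  rw [Real.norm_of_nonneg (Real.rpow_nonneg hn0 _), Real.norm_of_nonneg (Nat.cast_nonneg _)]
  have ht2 : (n : ℝ) ^ (2 / 3 : ℝ) = ((n : ℝ) ^ (1 / 3 : ℝ)) ^ 2 := by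
    rw [← Real.rpow_natCast, ← Real.rpow_mul hn0]; norm_num
  rw [ht2] at key ⊢
  set t : ℝ := (n : ℝ) ^ (1 / 3 : ℝ)
  rw [div_le_iff₀ hc] at hlarge
  have ht0 : 0 ≤ t := Real.rpow_nonneg hn0 _
  rw [div_mul_eq_mul_div, le_div_iff₀ hc]
  nlinarith [mul_le_mul_of_nonneg_left hlarge ht0]
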